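/- Let $(\Omega,\mathcal F,(\mathcal F_t)_{t\ge0},\mathbb Q)$ be a filtered probability space carrying a standard $(\mathcal F_t)$-Brownian motion $Z$. Let $H\in(0,\tfrac12)$, $\nu>0$, $T\ge0$, $\Delta>0$, write $H_\pm=H\pm\tfrac12$, and let $C_H=\sqrt{\frac{2H\,\Gamma(2-H_+)}{\Gamma(H_+)\,\Gamma(2-2H)}}$. Let the initial forward variance curve $\xi_0$ be deterministic, with $\xi_0>0$ and $\xi_0$ integrable on $[T,T+\Delta]$. In the rough Bergomi model the instantaneous variance is $$V_t=\xi_0(t)\exp\Big(2\nu C_H\mathcal V_t-\tfrac{\nu^2C_H^2}{H}t^{2H}\Big),\qquad \mathcal V_t=\int_0^t(t-u)^{H_-}\,\mathrm dZ_u .$$ Let $(\xi_T(t))_{t\in[T,T+\Delta]}$ be a jointly measurable version of the forward variance curve $\xi_T(t)=\mathbb E[V_t\mid\mathcal F_T]$, and put $\Delta\mathrm{VIX}^2_T:=\int_T^{T+\Delta}\xi_T(t)\,\mathrm dt$. Let $\mathrm F(x)={}_2F_1(-H_-,H_+;1+H_+;x)$ for $x\le0$, where ${}_2F_1$ is the hypergeometric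 function, i.e. the analytic continuation of the Gauss series to $\mathbb C\setminus[1,\infty)$. Then $\Delta\mathrm{VIX}^2_T$ is almost surely well defined and positive, and is square integrable, with $$\mathbb E\big[\Delta\mathrm{VIX}^2_T\big]=\int_T^{T+\Delta}\xi_0(t)\,\mathrm dt,$$ $$\mathbb E\big[(\Delta\mathrm{VIX}^2_T)^2\big]=\int_{[T,T+\Delta]^2}\xi_0(u)\xi_0(t)\exp\Big\{\tfrac{\nu^2C_H^2}{H}\big[(u-T)^{2H}+(t-T)^{2H}-u^{2H}-t^{2H}\big]\Big\}\,\mathrm e^{\overline\Theta_{u,t}}\,\mathrm du\,\mathrm dt,$$ where the last integrand is integrable, $\overline\Theta_{u,t}=0$ if $u=t$, $\overline\Theta_{u,t}=\Theta_{u\vee t,\,u\wedge t}$ otherwise, and for $u>t$ $$\Theta_{u,t}=2\nu^2C_H^2\Big\{\tfrac{u^{2H}-(u-T)^{2H}+t^{2H}-(t-T)^{2H}}{2H}+2\tfrac{(u-t)^{H_-}}{H_+}\Big[t^{H_+}\mathrm F\Big(\tfrac{-t}{u-t}\Big)-(t-T)^{H_+}\mathrm F\Big(\tfrac{T-t}{u-t}\Big)\Big]\Big\}.$$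 Moreover, put $$\sigma^2:=-2\log\mathbb E\big[\Delta\mathrm{VIX}^2_T\big]+\log\mathbb E\big[(\Delta\mathrm{VIX}^2_T)^2\big],\qquad \mu:=\log\mathbb E\big[\Delta\mathrm{VIX}^2_T\big]-\tfrac{\sigma^2}{2}.$$ Then $\sigma^2\ge0$, and $\mathcal N(\mu,\sigma^2)$ is the unique (possibly degenerate) Gaussian law whose exponential has the same first two moments as $\Delta\mathrm{VIX}^2_T$. In particular, if $\log(\Delta\mathrm{VIX}^2_T)$ is Gaussian, then $\mathbb V(\log(\Delta\mathrm{VIX}^2_T))=\sigma^2$ and $\mathbb E(\log(\Delta\mathrm{VIX}^2_T))=\mu$. -/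

import Mathlib

open MeasureTheory ProbabilityTheory Set
open scoped NNReal ENNReal

namespace RoughBergomi

noncomputable section

/-! ### The hypergeometric function -/

/-- `G` is holomorphic on the cut plane `ℂ ∖ [1, ∞)` and equal to the sum of the Gauss
hypergeometric series on the open unit disc. As the cut plane is connected, at most one function
on the cut plane has these properties. -/
def IsHypergeometricContinuation (a b c : ℂ) (G : ℂ → ℂ) : Prop :=
  DifferentiableOn ℂ G {z : ℂ | 1 - z ∈ Complex.slitPlane} ∧
    ∀ z : ℂ, ‖z‖ < 1 → G z = ordinaryHypergeometric a b c z

open Classical in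
/-- The (principal branch of the) hypergeometric function `₂F₁(a, b; c; ·)`: the analytic
continuation of the Gauss series from the unit disc to `ℂ ∖ [1, ∞)`. Mathlib's
`ordinaryHypergeometric` is only the sum of the series, which diverges for `‖z‖ > 1`. -/
def hyp2F1 (a b c z : ℂ) : ℂ :=
  if h : ∃ G : ℂ → ℂ, IsHypergeometricContinuation a b c G then h.choose z else 0

/-- `F(x) = ₂F₁(-H₋, H₊; 1 + H₊; x)` for real `x ≤ 0`, where `H₋ = H - 1/2`, `H₊ = H + 1/2`. -/
def hypF (H x : ℝ) : ℝ :=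
  (hyp2F1 ((-(H - 1 / 2) : ℝ) : ℂ) ((H + 1 / 2 : ℝ) : ℂ) ((1 + (H + 1 / 2) : ℝ) : ℂ) (x : ℂ)).re

/-! ### Brownian motion on a filtered space and the Wiener integral -/

variable {Ω : Type*} {m : MeasurableSpace Ω}

/-- `Z` is a standard one-dimensional Brownian motion with respect to the filtration `ℱ`. -/
structure IsBrownianWrt (Z : ℝ≥0 → Ω → ℝ) (ℱ : Filtration ℝ≥0 m) (Q : Measure Ω) : Prop where
  isBrownian : IsBrownianReal Z Q
  adapted : ∀ t : ℝ≥0, Measurable[ℱ t] (Z t)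
  indep : ∀ s t : ℝ≥0, s ≤ t →
    Indep (MeasurableSpace.comap (fun ω => Z t ω - Z s ω) inferInstance) (ℱ s) Q

/-- The step function `∑ i, c i · 1_{(a i, b i]}`. -/
def stepFun {n : ℕ} (a b : Fin n → ℝ≥0) (c : Fin n → ℝ) (u : ℝ) : ℝ :=
  ∑ i, (Ioc (a i : ℝ) (b i : ℝ)).indicator (fun _ => c i) u

/-- The integral `∑ i, c i · (Z (b i) - Z (a i))` of a step function. -/
def stepIntegral (Z : ℝ≥0 → Ω → ℝ) {n : ℕ} (a b : Fin n → ℝ≥0) (c : Fin n → ℝ) (ω : Ω) : ℝ :=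
  ∑ i, c i * (Z (b i) ω - Z (a i) ω)

/-- `X` is (a version of) the Wiener integral `∫₀^∞ f(u) dZ_u` of a deterministic function `f`
vanishing on `(-∞, 0]`: the `L²(Q)`-limit of the integrals of step functions which converge to
`f` in `L²`. -/
def IsWienerIntegral (Q : Measure Ω) (Z : ℝ≥0 → Ω → ℝ) (f : ℝ → ℝ) (X : Ω → ℝ) : Prop :=
  MemLp X 2 Q ∧ ∀ ε : ℝ≥0∞, 0 < ε →
    ∃ (n : ℕ) (a b : Fin n → ℝ≥0) (c : Fin n → ℝ), (∀ i, a i ≤ b i) ∧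
      eLpNorm (fun u => f u - stepFun a b c u) 2 volume < ε ∧
      eLpNorm (fun ω => X ω - stepIntegral Z a b c ω) 2 Q < ε

open Classical in
/-- The Wiener integral `∫₀^∞ f(u) dZ_u`, unique up to `Q`-null sets. -/
def wienerIntegral (Q : Measure Ω) (Z : ℝ≥0 → Ω → ℝ) (f : ℝ → ℝ) : Ω → ℝ :=
  if h : ∃ X : Ω → ℝ, IsWienerIntegral Q Z f X then h.choose else 0

/-! ### The rough Bergomi model -/

/-- `C_H = √(2 H Γ(2 - H₊) / (Γ(H₊) Γ(2 - 2H)))`. -/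
def constC (H : ℝ) : ℝ :=
  √(2 * H * Real.Gamma (2 - (H + 1 / 2)) / (Real.Gamma (H + 1 / 2) * Real.Gamma (2 - 2 * H)))

/-- The Volterra process `𝒱_t = ∫₀^t (t - u)^{H - 1/2} dZ_u`. -/
def volterra (Q : Measure Ω) (Z : ℝ≥0 → Ω → ℝ) (H t : ℝ) : Ω → ℝ :=
  wienerIntegral Q Z ((Ioc 0 t).indicator fun u => (t - u) ^ (H - 1 / 2))

/-- The instantaneous variance `V_t = ξ₀(t) ℰ(2 ν C_H 𝒱_t)`, where
`ℰ(λ 𝒱_t) = exp(λ 𝒱_t - (λ² / 2) [𝒱]_t)` and `[𝒱]_t = t^{2H} / (2H)`. -/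
def instVariance (Q : Measure Ω) (Z : ℝ≥0 → Ω → ℝ) (ξ₀ : ℝ → ℝ) (ν H t : ℝ) (ω : Ω) : ℝ :=
  ξ₀ t * Real.exp (2 * ν * constC H * volterra Q Z H t ω
    - (2 * ν * constC H) ^ 2 / 2 * (t ^ (2 * H) / (2 * H)))

/-- `ξ t = ξ_T(t) = 𝔼[V_t | ℱ_T]`, for `t ∈ [T, T + Δ]`, is a jointly measurable version of the
forward variance curve observed at time `T`. -/
structure IsForwardVariance (Q : Measure Ω) (ℱ : Filtration ℝ≥0 m) (Z : ℝ≥0 → Ω → ℝ)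
    (ξ₀ : ℝ → ℝ) (ν H : ℝ) (T : ℝ≥0) (Δ : ℝ) (ξ : ℝ → Ω → ℝ) : Prop where
  jointlyMeasurable :
    AEStronglyMeasurable (Function.uncurry ξ) ((volume.restrict (Icc (T : ℝ) (T + Δ))).prod Q)
  ae_eq_condExp : ∀ t ∈ Icc (T : ℝ) (T + Δ), ξ t =ᵐ[Q] Q[instVariance Q Z ξ₀ ν H t | ℱ T]

/-- `ΔVIX²_T = ∫_T^{T+Δ} ξ_T(t) dt`. -/
def deltaVIXSq (ξ : ℝ → Ω → ℝ) (T : ℝ≥0) (Δ : ℝ) (ω : Ω) : ℝ :=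
  ∫ t in (T : ℝ)..(T + Δ), ξ t ω

/-- `Θ_{u,t}`, for `u > t`. -/
def theta (ν H T u t : ℝ) : ℝ :=
  2 * ν ^ 2 * constC H ^ 2 *
    ((u ^ (2 * H) - (u - T) ^ (2 * H) + t ^ (2 * H) - (t - T) ^ (2 * H)) / (2 * H)
      + 2 * ((u - t) ^ (H - 1 / 2) / (H + 1 / 2)) *
        (t ^ (H + 1 / 2) * hypF H (-t / (u - t))
          - (t - T) ^ (H + 1 / 2) * hypF H ((T - t) / (u - t))))

open Classical in
/-- `Θ̄_{u,t}`: zero on the diagonal, `Θ_{u ∨ t, u ∧ t}` off the diagonal. -/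
def thetaBar (ν H T u t : ℝ) : ℝ :=
  if u = t then 0 else theta ν H T (max u t) (min u t)

/-- The integrand of the second moment formula. -/
def secondMomentIntegrand (ξ₀ : ℝ → ℝ) (ν H T : ℝ) (p : ℝ × ℝ) : ℝ :=
  ξ₀ p.1 * ξ₀ p.2 *
    Real.exp (ν ^ 2 * constC H ^ 2 / H *
      ((p.1 - T) ^ (2 * H) + (p.2 - T) ^ (2 * H) - p.1 ^ (2 * H) - p.2 ^ (2 * H))) *
    Real.exp (thetaBar ν H T p.1 p.2)

end

end RoughBergomi

/-! Write `κ = 2νC_H` and let `k_t(s) = (t - s)^{H₋}` on `(0, T]`. Splitting the Volterra integral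
at `T` gives `𝒱_t = X_t + Y_t`, where `X_t = ∫ k_t dZ` is measurable for `ℱ T` and `exp(κ Y_t)`,
which involves only later increments, has a constant conditional expectation. Hence `ξ_T(t) = ξ₀(t)
exp(κ X_t - κ²‖k_t‖²/2)` (`condExp_instVariance`). This has mean `ξ₀(t)`, and since `X_u + X_t` is
the Wiener integral of `k_u + k_t`, polarisation gives `𝔼[ξ_T(u) ξ_T(t)] = ξ₀(u) ξ₀(t) exp(κ²⟨k_u,
k_t⟩)` (`IsForwardVariance.moments`). Tonelli then yields both moments of the integrated field
(`second_moment_of_field`).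

The hypergeometric terms come from `⟨k_u, k_t⟩`: with `r = t - s` it is a difference of integrals of
`r^{H₋} (u - t + r)^{H₋}` from `0`, each an Euler integral at a nonpositive argument
(`integral_sub_rpow_mul_sub_rpow`). The remaining terms of `Θ` cancel the exponential prefactor.

The law of a Wiener integral is never identified; only the quantities `𝔼[exp(l X); A]` are used.
They are computed for step functions by independence of increments and passed to the limit. As the
kernel is nonnegative and increasing, its left endpoint approximations stay below it, which supplies
both `L²` convergence and uniform exponential bounds (`IsLeftApproximable.exists_wienerIntegral`).

The last claims reduce to a linear system: the logarithms of the two exponential moments of `𝒩(a,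
v)` are `a + v/2` and `2a + 2v`. -/

namespace RoughBergomi

noncomputable section

open Filter Topology

/-! ### Euler's integral as the analytic continuation of the Gauss series -/

/-- Euler's integral for `₂F₁(a, b; 1 + b; z)`. -/
def eulerIntegral (a b : ℝ) (z : ℂ) : ℂ :=
  b * ∫ y in Ioc (0 : ℝ) 1, ((y ^ (b - 1) : ℝ) : ℂ) * (1 - z * y) ^ (-(a : ℂ))

/-- The point is `(1 - y)·1 + y(1 - z)`, and the slit plane is star-shaped about `1`. This keeps the
base of the complex power in Euler's integrand off the branch cut. -/
lemma one_sub_mul_mem_slitPlane {z : ℂ} (hz : 1 - z ∈ Complex.slitPlane) {y : ℝ}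
    (hy : y ∈ Icc (0 : ℝ) 1) : 1 - z * y ∈ Complex.slitPlane := by
  have := (Complex.starConvex_one_slitPlane) hz (a := 1 - y) (b := y) (by linarith [hy.2]) hy.1
    (by ring)
  convert! this using 1
  simp only [Complex.real_smul]
  push_cast
  ring

lemma isOpen_cutPlane : IsOpen {z : ℂ | 1 - z ∈ Complex.slitPlane} :=
  Complex.isOpen_slitPlane.preimage (by fun_prop)

lemma isPreconnected_cutPlane : IsPreconnected {z : ℂ | 1 - z ∈ Complex.slitPlane} := by
  have : StarConvex ℝ (0 : ℂ) {z : ℂ | 1 - z ∈ Complex.slitPlane} := by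
    intro z hz a b ha hb hab
    have := one_sub_mul_mem_slitPlane hz (y := b) ⟨hb, by linarith⟩
    simpa [mul_comm] using this
  exact (this.isPathConnected (by simp)).isConnected.isPreconnected

lemma integrableOn_rpow_sub_one {b : ℝ} (hb : 0 < b) :
    IntegrableOn (fun y : ℝ => y ^ (b - 1)) (Ioc 0 1) :=
  (intervalIntegral.intervalIntegrable_rpow' (by linarith)).1

lemma aestronglyMeasurable_euler_integrand (b : ℝ) (c z : ℂ)
    (hz : 1 - z ∈ Complex.slitPlane) :
    AEStronglyMeasurable (fun y : ℝ => ((y ^ (b - 1) : ℝ) : ℂ) * (1 - z * y) ^ c)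
      (volume.restrict (Ioc (0 : ℝ) 1)) := by
  refine ContinuousOn.aestronglyMeasurable ?_ measurableSet_Ioc
  refine ContinuousOn.mul ?_ ?_
  · refine Complex.continuous_ofReal.comp_continuousOn ?_
    exact ContinuousOn.rpow_const continuousOn_id (fun y hy => Or.inl hy.1.ne')
  · refine ContinuousOn.cpow_const (by fun_prop) fun y hy => ?_
    exact one_sub_mul_mem_slitPlane hz (Ioc_subset_Icc_self hy)

lemma exists_bound_cpow (c : ℂ) {K : Set ℂ} (hK : IsCompact K)
    (hKU : K ⊆ {z : ℂ | 1 - z ∈ Complex.slitPlane}) :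
    ∃ M : ℝ, ∀ z ∈ K, ∀ y ∈ Icc (0 : ℝ) 1, ‖(1 - z * (y : ℂ)) ^ c‖ ≤ M := by
  have hc : ContinuousOn (fun p : ℂ × ℝ => (1 - p.1 * (p.2 : ℂ)) ^ c) (K ×ˢ Icc (0 : ℝ) 1) := by
    refine ContinuousOn.cpow_const (by fun_prop) fun p hp => ?_
    exact one_sub_mul_mem_slitPlane (hKU hp.1) hp.2
  obtain ⟨M, hM⟩ := (hK.prod isCompact_Icc).exists_bound_of_continuousOn hc
  exact ⟨M, fun z hz y hy => hM (z, y) ⟨hz, hy⟩⟩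

lemma integrable_euler_integrand {b : ℝ} (hb : 0 < b) (c z : ℂ)
    (hz : 1 - z ∈ Complex.slitPlane) :
    Integrable (fun y : ℝ => ((y ^ (b - 1) : ℝ) : ℂ) * (1 - z * y) ^ c)
      (volume.restrict (Ioc (0 : ℝ) 1)) := by
  obtain ⟨M, hM⟩ := exists_bound_cpow c (isCompact_singleton (x := z)) (by simpa using hz)
  refine ((integrableOn_rpow_sub_one hb).mul_const M).mono'
    (aestronglyMeasurable_euler_integrand b c z hz) ?_
  filter_upwards [ae_restrict_mem measurableSet_Ioc] with y hy
  rw [norm_mul, Complex.norm_real, Real.norm_of_nonneg (Real.rpow_nonneg hy.1.le _)]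
  exact mul_le_mul_of_nonneg_left (hM z rfl y (Ioc_subset_Icc_self hy)) (Real.rpow_nonneg hy.1.le _)

/-- Differentiation under the integral sign: on a small closed ball the power factor is bounded by
compactness, and `y^(b-1)` is integrable because `b > 0`. -/
lemma differentiableOn_eulerIntegral (a : ℝ) {b : ℝ} (hb : 0 < b) :
    DifferentiableOn ℂ (eulerIntegral a b) {z : ℂ | 1 - z ∈ Complex.slitPlane} := by
  intro z₀ hz₀
  refine DifferentiableAt.differentiableWithinAt ?_
  obtain ⟨ε, hε, hball⟩ := Metric.nhds_basis_closedBall.mem_iff.1 (isOpen_cutPlane.mem_nhds hz₀)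
  obtain ⟨M, hM⟩ := exists_bound_cpow (-(a : ℂ) - 1) (isCompact_closedBall z₀ ε) hball
  have key := hasDerivAt_integral_of_dominated_loc_of_deriv_le
    (μ := volume.restrict (Ioc (0 : ℝ) 1)) (x₀ := z₀) (s := Metric.closedBall z₀ ε)
    (F := fun z y => ((y ^ (b - 1) : ℝ) : ℂ) * (1 - z * y) ^ (-(a : ℂ)))
    (F' := fun z y => ((y ^ (b - 1) : ℝ) : ℂ) * (-(a : ℂ) * (1 - z * y) ^ (-(a : ℂ) - 1) * (-y)))
    (bound := fun y => y ^ (b - 1) * (|a| * M))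
    (Metric.closedBall_mem_nhds z₀ hε)
    (by
      filter_upwards [isOpen_cutPlane.mem_nhds hz₀] with z hz
      exact aestronglyMeasurable_euler_integrand b _ z hz)
    (integrable_euler_integrand hb _ z₀ hz₀)
    (by
      have := (aestronglyMeasurable_euler_integrand b (-(a : ℂ) - 1) z₀ hz₀).mul
        (g := fun y : ℝ => (a : ℂ) * y) (Continuous.aestronglyMeasurable (by fun_prop))
      refine this.congr (Eventually.of_forall fun y => ?_)
      simp only [Pi.mul_apply]
      ring)
    (by
      filter_upwards [ae_restrict_mem measurableSet_Ioc] with y hy z hz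
      have h1 := hM z hz y (Ioc_subset_Icc_self hy)
      have h0 : 0 ≤ ‖(1 - z * (y : ℂ)) ^ (-(a : ℂ) - 1)‖ := norm_nonneg _
      rw [norm_mul, Complex.norm_real, Real.norm_of_nonneg (Real.rpow_nonneg hy.1.le _)]
      refine mul_le_mul_of_nonneg_left ?_ (Real.rpow_nonneg hy.1.le _)
      rw [norm_mul, norm_mul, norm_neg, norm_neg, Complex.norm_real, Complex.norm_real,
        Real.norm_eq_abs, Real.norm_of_nonneg hy.1.le]
      calc _ ≤ |a| * ‖(1 - z * (y : ℂ)) ^ (-(a : ℂ) - 1)‖ * 1 := by gcongr; exact hy.2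
        _ ≤ _ := by rw [mul_one]; gcongr)
    ((integrableOn_rpow_sub_one hb).mul_const _)
    (by
      filter_upwards [ae_restrict_mem measurableSet_Ioc] with y hy z hz
      have hd : HasDerivAt (fun z : ℂ => 1 - z * (y : ℂ)) (-y) z := by
        simpa using ((hasDerivAt_id z).mul_const (y : ℂ)).const_sub 1
      exact (hd.cpow_const
        (one_sub_mul_mem_slitPlane (hball hz) (Ioc_subset_Icc_self hy))).const_mul _)
  exact (key.2.differentiableAt).const_mul (b : ℂ)

/-- Both sides are the rising factorial `(b)_{n+1}`, split at its first or at its last factor. It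
converts `(b)_n / (1+b)_n` into `b / (b+n)`. -/
lemma mul_ascPochhammer_eval_add_one (b : ℂ) (n : ℕ) :
    b * (ascPochhammer ℂ n).eval (1 + b) = (ascPochhammer ℂ n).eval b * (b + n) := by
  have h1 := congrArg (Polynomial.eval b) (ascPochhammer_succ_left ℂ n)
  have h2 := congrArg (Polynomial.eval b) (ascPochhammer_succ_right ℂ n)
  rw [h1] at h2
  simpa [add_comm] using h2

/-- The coefficients of the expansion of `(1 - w) ^ (-a)`. -/
def binomCoeff (a : ℂ) (n : ℕ) : ℂ := (n.factorial : ℂ)⁻¹ * (ascPochhammer ℂ n).eval a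

lemma hasSum_one_sub_cpow (a : ℂ) {w : ℂ} (hw : ‖w‖ < 1) :
    HasSum (fun n : ℕ => binomCoeff a n * w ^ n) ((1 - w) ^ (-a)) := by
  have h := (Complex.one_add_cpow_hasFPowerSeriesOnBall_zero (a := -a)).hasSum (y := -w)
    (by
      rw [Metric.mem_eball, edist_zero_right, enorm_neg, enorm_eq_nnnorm]
      exact_mod_cast (show ‖w‖₊ < 1 from hw))
  rw [zero_add, ← sub_eq_add_neg] at h
  convert! h using 2 with n
  -- The binomial series is `₂F₁` with one upper and the lower parameter equal. Their common value
  -- cancels, so `1` is only a convenient choice avoiding zero denominators.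
  rw [binomialSeries_eq_ordinaryHypergeometricSeries (b := (1 : ℂ)) (fun k => by
    intro hk
    have := congrArg Complex.re hk
    simp only [Complex.natCast_re, Complex.neg_re, Complex.one_re] at this
    linarith [(Nat.cast_nonneg k : (0 : ℝ) ≤ k)]), neg_neg]
  rw [FormalMultilinearSeries.compContinuousLinearMap_apply]
  have : (⇑(-ContinuousLinearMap.id ℂ ℂ) ∘ fun _ : Fin n => -w) = fun _ => w := by
    ext; simp
  rw [this, ordinaryHypergeometricSeries_apply_eq, mul_inv_cancel_right₀, binomCoeff, smul_eq_mul]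
  rw [Ne, ascPochhammer_eval_eq_zero_iff]
  rintro ⟨k, -, hk⟩
  have := congrArg Complex.re hk
  simp only [Complex.natCast_re, Complex.neg_re, Complex.one_re] at this
  linarith [(Nat.cast_nonneg k : (0 : ℝ) ≤ k)]

lemma summable_norm_binomCoeff (a : ℂ) {r : ℝ} (hr0 : 0 ≤ r) (hr : r < 1) :
    Summable (fun n : ℕ => ‖binomCoeff a n‖ * r ^ n) := by
  have := (hasSum_one_sub_cpow a (w := (r : ℂ)) (by simpa [abs_of_nonneg hr0])).summable.norm
  simpa [abs_of_nonneg hr0] using this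

lemma integral_rpow_mul_pow {b : ℝ} (hb : 0 < b) (n : ℕ) :
    ∫ y in Ioc (0 : ℝ) 1, (((y ^ (b - 1) : ℝ) : ℂ) * (y : ℂ) ^ n) = ((b : ℂ) + n)⁻¹ := by
  have h1 : ∫ y in Ioc (0 : ℝ) 1, (((y ^ (b - 1) : ℝ) : ℂ) * (y : ℂ) ^ n)
      = ∫ y in Ioc (0 : ℝ) 1, ((y ^ (b - 1 + n) : ℝ) : ℂ) := by
    refine setIntegral_congr_fun measurableSet_Ioc fun y hy => ?_
    rw [Real.rpow_add_natCast hy.1.ne']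
    push_cast
    rfl
  have hn : (0 : ℝ) ≤ n := Nat.cast_nonneg n
  rw [h1, integral_complex_ofReal, ← intervalIntegral.integral_of_le zero_le_one,
    integral_rpow (Or.inl (by linarith)), Real.one_rpow, Real.zero_rpow (by linarith)]
  push_cast
  rw [sub_zero, one_div]
  congr 1
  ring

/-- Expand `(1 - zy)^(-a)` by the binomial series and integrate termwise against `y^(b-1)`; each
power contributes `1/(b+n)`. Domination comes from absolute convergence at radius `‖z‖ < 1`. -/
lemma eulerIntegral_eq_ordinaryHypergeometric (a : ℝ) {b : ℝ} (hb : 0 < b) {z : ℂ}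
    (hz : ‖z‖ < 1) :
    eulerIntegral a b z = ordinaryHypergeometric (a : ℂ) (b : ℂ) ((1 + b : ℝ) : ℂ) z := by
  have key := hasSum_integral_of_dominated_convergence (μ := volume.restrict (Ioc (0 : ℝ) 1))
    (F := fun (n : ℕ) (y : ℝ) =>
      ((y ^ (b - 1) : ℝ) : ℂ) * (binomCoeff a n * (z * y) ^ n))
    (f := fun y : ℝ => ((y ^ (b - 1) : ℝ) : ℂ) * (1 - z * y) ^ (-(a : ℂ)))
    (fun n y => y ^ (b - 1) * (‖binomCoeff a n‖ * ‖z‖ ^ n))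
    (fun n => by
      refine ContinuousOn.aestronglyMeasurable ?_ measurableSet_Ioc
      refine ContinuousOn.mul ?_ (by fun_prop)
      refine Complex.continuous_ofReal.comp_continuousOn ?_
      exact ContinuousOn.rpow_const continuousOn_id (fun y hy => Or.inl hy.1.ne'))
    (fun n => by
      filter_upwards [ae_restrict_mem measurableSet_Ioc] with y hy
      rw [norm_mul, Complex.norm_real, Real.norm_of_nonneg (Real.rpow_nonneg hy.1.le _), norm_mul,
        norm_pow, norm_mul, Complex.norm_real, Real.norm_of_nonneg hy.1.le]
      have := hy.1.le
      have := Real.rpow_nonneg hy.1.le (b - 1)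
      gcongr
      exact mul_le_of_le_one_right (norm_nonneg _) hy.2)
    (Eventually.of_forall fun y =>
      (summable_norm_binomCoeff a (norm_nonneg z) hz).mul_left _)
    (by
      simp_rw [tsum_mul_left]
      exact (integrableOn_rpow_sub_one hb).mul_const _)
    (by
      filter_upwards [ae_restrict_mem measurableSet_Ioc] with y hy
      refine (hasSum_one_sub_cpow (a : ℂ) ?_).mul_left _
      rw [norm_mul, Complex.norm_real, Real.norm_of_nonneg hy.1.le]
      exact (mul_le_of_le_one_right (norm_nonneg _) hy.2).trans_lt hz)
  rw [ordinaryHypergeometric_eq_tsum, eulerIntegral, ← key.tsum_eq, ← tsum_mul_left]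
  refine tsum_congr fun n => ?_
  have h2 : ∫ y in Ioc (0 : ℝ) 1, ((y ^ (b - 1) : ℝ) : ℂ) * (binomCoeff a n * (z * y) ^ n)
      = binomCoeff a n * z ^ n * ((b : ℂ) + n)⁻¹ := by
    rw [← integral_rpow_mul_pow hb, ← integral_const_mul]
    refine integral_congr_ae (Eventually.of_forall fun y => ?_)
    simp only [mul_pow]
    ring
  rw [h2]
  have hbn : (b : ℂ) + n ≠ 0 := by
    have : (0 : ℝ) < b + n := by positivity
    exact_mod_cast this.ne'
  have hasc : (ascPochhammer ℂ n).eval ((1 + b : ℝ) : ℂ) ≠ 0 := by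
    rw [Ne, ascPochhammer_eval_eq_zero_iff]
    rintro ⟨k, -, hk⟩
    have := congrArg Complex.re hk
    simp only [Complex.natCast_re, Complex.neg_re, Complex.ofReal_re] at this
    linarith [(Nat.cast_nonneg k : (0 : ℝ) ≤ k)]
  have hrel := mul_ascPochhammer_eval_add_one (b : ℂ) n
  rw [show (1 + (b : ℂ)) = ((1 + b : ℝ) : ℂ) by push_cast; rfl] at hrel
  rw [smul_eq_mul, binomCoeff]
  field_simp
  linear_combination (n.factorial : ℂ)⁻¹ * (ascPochhammer ℂ n).eval (a : ℂ) * z ^ n * hrel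

lemma isHypergeometricContinuation_eulerIntegral (a : ℝ) {b : ℝ} (hb : 0 < b) :
    IsHypergeometricContinuation (a : ℂ) (b : ℂ) ((1 + b : ℝ) : ℂ) (eulerIntegral a b) :=
  ⟨differentiableOn_eulerIntegral a hb,
    fun _ hz => eulerIntegral_eq_ordinaryHypergeometric a hb hz⟩

/-- Identity theorem on the connected cut plane. It makes the arbitrary choice in `hyp2F1` harmless
there. -/
lemma IsHypergeometricContinuation.eqOn {a b c : ℂ} {G₁ G₂ : ℂ → ℂ}
    (h₁ : IsHypergeometricContinuation a b c G₁) (h₂ : IsHypergeometricContinuation a b c G₂) :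
    EqOn G₁ G₂ {z : ℂ | 1 - z ∈ Complex.slitPlane} := by
  refine AnalyticOnNhd.eqOn_of_preconnected_of_eventuallyEq (z₀ := 0)
    (h₁.1.analyticOnNhd isOpen_cutPlane) (h₂.1.analyticOnNhd isOpen_cutPlane)
    isPreconnected_cutPlane (by simp) ?_
  filter_upwards [Metric.ball_mem_nhds (0 : ℂ) one_pos] with z hz
  rw [h₁.2 z (by simpa using hz), h₂.2 z (by simpa using hz)]

lemma hyp2F1_eq_eulerIntegral (a : ℝ) {b : ℝ} (hb : 0 < b) {z : ℂ}
    (hz : 1 - z ∈ Complex.slitPlane) :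
    hyp2F1 (a : ℂ) (b : ℂ) ((1 + b : ℝ) : ℂ) z = eulerIntegral a b z := by
  have h : ∃ G : ℂ → ℂ, IsHypergeometricContinuation (a : ℂ) (b : ℂ) ((1 + b : ℝ) : ℂ) G :=
    ⟨_, isHypergeometricContinuation_eulerIntegral a hb⟩
  rw [hyp2F1, dif_pos h]
  exact h.choose_spec.eqOn (isHypergeometricContinuation_eulerIntegral a hb) hz

/-- On the negative axis the base `1 + xy` is a positive real, so Euler's integral is real and
taking real parts loses nothing. -/
lemma hypF_neg {H x : ℝ} (hH : 0 < H) (hx : 0 ≤ x) :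
    hypF H (-x) = (H + 1 / 2) *
      ∫ y in (0 : ℝ)..1, y ^ (H - 1 / 2) * (1 + x * y) ^ (H - 1 / 2) := by
  have hb : 0 < H + 1 / 2 := by linarith
  rw [hypF, hyp2F1_eq_eulerIntegral _ hb, eulerIntegral, Complex.re_ofReal_mul,
    intervalIntegral.integral_of_le zero_le_one]
  · congr 1
    rw [← Complex.ofReal_re (∫ y in Ioc (0 : ℝ) 1, y ^ (H - 1 / 2) * (1 + x * y) ^ (H - 1 / 2)),
      ← integral_complex_ofReal]
    congr 1
    refine setIntegral_congr_fun measurableSet_Ioc fun y hy => ?_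
    have : 0 ≤ 1 + x * y := by have := hy.1; positivity
    simp only [Complex.ofReal_mul]
    rw [Complex.ofReal_cpow this]
    push_cast
    ring_nf
  · left
    simp only [Complex.ofReal_neg, sub_neg_eq_add, Complex.add_re, Complex.one_re,
      Complex.ofReal_re]
    linarith

/-- `∫₀ˣ r^{H₋} (d + r)^{H₋} dr` in terms of the hypergeometric function. -/
lemma integral_rpow_mul_add_rpow {H d x : ℝ} (hH : 0 < H) (hd : 0 < d) (hx : 0 ≤ x) :
    ∫ r in (0 : ℝ)..x, r ^ (H - 1 / 2) * (d + r) ^ (H - 1 / 2) =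
      d ^ (H - 1 / 2) / (H + 1 / 2) * (x ^ (H + 1 / 2) * hypF H (-(x / d))) := by
  -- The rescaling `r = x y` to the unit interval needs `x ≠ 0`; for `x = 0` both sides vanish. This
  -- is the case `t = T` of the covariance formula.
  rcases hx.eq_or_lt with rfl | hx
  · rw [Real.zero_rpow (by linarith)]
    simp
  have hsub := intervalIntegral.integral_comp_mul_left (a := 0) (b := 1)
    (fun r : ℝ => r ^ (H - 1 / 2) * (d + r) ^ (H - 1 / 2)) hx.ne'
  rw [mul_zero, mul_one, smul_eq_mul] at hsub
  have hpt : ∫ y in (0 : ℝ)..1, (x * y) ^ (H - 1 / 2) * (d + x * y) ^ (H - 1 / 2)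
      = x ^ (H - 1 / 2) * d ^ (H - 1 / 2) *
        ∫ y in (0 : ℝ)..1, y ^ (H - 1 / 2) * (1 + x / d * y) ^ (H - 1 / 2) := by
    rw [← intervalIntegral.integral_const_mul]
    refine intervalIntegral.integral_congr fun y hy => ?_
    rw [uIcc_of_le zero_le_one] at hy
    have hy0 := hy.1
    rw [Real.mul_rpow hx.le hy0, show d + x * y = d * (1 + x / d * y) by field_simp,
      Real.mul_rpow hd.le (by positivity)]
    ring
  rw [hpt] at hsub
  rw [hypF_neg hH (by positivity)]
  have hx1 : x ^ (H + 1 / 2) = x * x ^ (H - 1 / 2) := by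
    rw [show H + 1 / 2 = 1 + (H - 1 / 2) by ring, Real.rpow_add hx, Real.rpow_one]
  rw [hx1]
  have hb : H + 1 / 2 ≠ 0 := by linarith
  have := hx.ne'
  field_simp at hsub ⊢
  linear_combination -hsub

lemma intervalIntegrable_rpow_mul_add_rpow {H d x : ℝ} (hH : 0 < H) (hd : 0 < d) (hx : 0 ≤ x) :
    IntervalIntegrable (fun r => r ^ (H - 1 / 2) * (d + r) ^ (H - 1 / 2)) volume 0 x := by
  refine (intervalIntegral.intervalIntegrable_rpow' (by linarith)).mul_continuousOn ?_
  refine ContinuousOn.rpow_const (by fun_prop) fun r hr => Or.inl ?_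
  rw [uIcc_of_le hx] at hr
  linarith [hr.1]

/-- The covariance of the Wiener integrals over `[0, T]` of the kernels at `u > t`. -/
lemma integral_sub_rpow_mul_sub_rpow {H T t u : ℝ} (hH : 0 < H) (hT : 0 ≤ T) (hTt : T ≤ t)
    (htu : t < u) :
    ∫ s in (0 : ℝ)..T, (u - s) ^ (H - 1 / 2) * (t - s) ^ (H - 1 / 2) =
      (u - t) ^ (H - 1 / 2) / (H + 1 / 2) *
        (t ^ (H + 1 / 2) * hypF H (-t / (u - t))
          - (t - T) ^ (H + 1 / 2) * hypF H ((T - t) / (u - t))) := by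
  have hd : 0 < u - t := by linarith
  have h1 := intervalIntegral.integral_comp_sub_left (a := 0) (b := T)
    (fun r : ℝ => r ^ (H - 1 / 2) * (u - t + r) ^ (H - 1 / 2)) t
  have h2 : ∫ s in (0 : ℝ)..T, (u - s) ^ (H - 1 / 2) * (t - s) ^ (H - 1 / 2)
      = ∫ s in (0 : ℝ)..T, (t - s) ^ (H - 1 / 2) * (u - t + (t - s)) ^ (H - 1 / 2) := by
    refine intervalIntegral.integral_congr fun s _ => ?_
    rw [show u - t + (t - s) = u - s by ring, mul_comm]
  rw [h2, h1, sub_zero, ← intervalIntegral.integral_interval_sub_left (a := 0)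
    (intervalIntegrable_rpow_mul_add_rpow hH hd (by linarith))
    (intervalIntegrable_rpow_mul_add_rpow hH hd (by linarith)),
    integral_rpow_mul_add_rpow hH hd (by linarith), integral_rpow_mul_add_rpow hH hd (by linarith),
    show -(t / (u - t)) = -t / (u - t) by ring,
    show -((t - T) / (u - t)) = (T - t) / (u - t) by ring]
  ring

/-! ### Convergence in `L²` and exponential moments -/

section L2

variable {α : Type*} {mα : MeasurableSpace α} {μ : Measure α}

lemma eLpNorm_two_eq_sqrt_integral_sq {f : α → ℝ} (hf : MemLp f 2 μ) :
    eLpNorm f 2 μ = ENNReal.ofReal √(∫ x, f x ^ 2 ∂μ) := by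
  rw [hf.eLpNorm_eq_integral_rpow_norm (by norm_num) (by norm_num), Real.sqrt_eq_rpow]
  norm_num

/-- A version of the dominated convergence theorem in `L²`. -/
lemma tendsto_eLpNorm_two_of_dominated {F : ℕ → α → ℝ} {f bound : α → ℝ}
    (hF : ∀ n, AEStronglyMeasurable (F n) μ) (hb : MemLp bound 2 μ)
    (hbound : ∀ n, ∀ᵐ x ∂μ, ‖F n x - f x‖ ≤ bound x)
    (hf : AEStronglyMeasurable f μ) (hlim : ∀ᵐ x ∂μ, Tendsto (fun n => F n x) atTop (𝓝 (f x))) :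
    Tendsto (fun n => eLpNorm (F n - f) 2 μ) atTop (𝓝 0) := by
  have hmem : ∀ n, MemLp (F n - f) 2 μ := fun n =>
    hb.mono' ((hF n).sub hf) (hbound n)
  simp_rw [fun n => eLpNorm_two_eq_sqrt_integral_sq (hmem n)]
  have h := tendsto_integral_of_dominated_convergence (μ := μ)
    (F := fun n x => (F n - f) x ^ 2) (f := fun _ => (0 : ℝ)) (fun x => bound x ^ 2)
    (fun n => (hmem n).1.pow 2) hb.integrable_sq
    (fun n => by
      filter_upwards [hbound n] with x hx
      rw [norm_pow]
      exact pow_le_pow_left₀ (norm_nonneg _) hx 2)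
    (by
      filter_upwards [hlim] with x hx
      have : Tendsto (fun n => (F n x - f x) ^ 2) atTop (𝓝 ((f x - f x) ^ 2)) :=
        (hx.sub_const _).pow 2
      simpa using this)
  rw [integral_zero] at h
  have h2 := (ENNReal.continuous_ofReal.comp Real.continuous_sqrt).tendsto (0 : ℝ)
  have h3 := h2.comp h
  simpa [Function.comp_def] using h3

/-- From `1 + z ≤ exp z`. The product form lets Cauchy–Schwarz turn `L²` convergence of exponents
into `L¹` convergence of exponentials. -/
lemma abs_exp_sub_exp_le (x y : ℝ) :
    |Real.exp x - Real.exp y| ≤ |x - y| * (Real.exp x + Real.exp y) := by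
  wlog h : y ≤ x generalizing x y
  · rw [abs_sub_comm, abs_sub_comm x, add_comm]
    exact this y x (le_of_not_ge h)
  have h1 : 0 ≤ Real.exp x - Real.exp y := by
    have := Real.exp_le_exp.2 h
    linarith
  rw [abs_of_nonneg h1, abs_of_nonneg (by linarith)]
  have h2 : Real.exp y = Real.exp x * Real.exp (y - x) := by
    rw [← Real.exp_add]; congr 1; ring
  have h3 := Real.add_one_le_exp (y - x)
  have h4 := Real.exp_pos x
  have h5 := Real.exp_pos y
  have h6 : Real.exp x - Real.exp y ≤ (x - y) * Real.exp x := by rw [h2]; nlinarith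
  nlinarith

/-- Exponential moments pass to the limit under `L²` convergence when the second moments of the
exponentials are bounded. -/
lemma exp_moments_of_tendsto_eLpNorm [IsFiniteMeasure μ] {X : ℕ → α → ℝ} {Y : α → ℝ}
    (hX : ∀ n, MemLp (X n) 2 μ) (hY : MemLp Y 2 μ)
    (hlim : Tendsto (fun n => eLpNorm (X n - Y) 2 μ) atTop (𝓝 0)) {K : ℝ}
    (hmem : ∀ n, MemLp (fun ω => Real.exp (X n ω)) 2 μ)
    (hK : ∀ n, ∫ ω, Real.exp (X n ω) ^ 2 ∂μ ≤ K) :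
    MemLp (fun ω => Real.exp (Y ω)) 2 μ ∧
      ∀ A : Set α, Tendsto (fun n => ∫ ω in A, Real.exp (X n ω) ∂μ) atTop
        (𝓝 (∫ ω in A, Real.exp (Y ω) ∂μ)) := by
  set C : ℝ≥0∞ := ENNReal.ofReal √K with hC
  have hbd : ∀ n, eLpNorm (fun ω => Real.exp (X n ω)) 2 μ ≤ C := fun n => by
    rw [eLpNorm_two_eq_sqrt_integral_sq (hmem n)]
    exact ENNReal.ofReal_le_ofReal (Real.sqrt_le_sqrt (hK n))
  -- Along an almost everywhere convergent subsequence, Fatou transfers the uniform `L²` bound to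
  -- `exp Y`.
  obtain ⟨ns, -, hns⟩ := (tendstoInMeasure_of_tendsto_eLpNorm_of_ne_top (by norm_num) (by norm_num)
    (fun n => (hX n).1) hY.1 hlim).exists_seq_tendsto_ae
  have hYm : AEStronglyMeasurable (fun ω => Real.exp (Y ω)) μ :=
    Real.continuous_exp.comp_aestronglyMeasurable hY.1
  have hYbd : eLpNorm (fun ω => Real.exp (Y ω)) 2 μ ≤ C := by
    refine Lp.eLpNorm_le_of_ae_tendsto (u := atTop) (f := fun n ω => Real.exp (X (ns n) ω))
      (Eventually.of_forall fun n => hbd _) (fun n => (hmem _).1) ?_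
    filter_upwards [hns] with ω hω
    exact (Real.continuous_exp.tendsto _).comp hω
  have hYmem : MemLp (fun ω => Real.exp (Y ω)) 2 μ := ⟨hYm, hYbd.trans_lt ENNReal.ofReal_lt_top⟩
  refine ⟨hYmem, fun A => tendsto_setIntegral_of_L1' _ hYm
    (Eventually.of_forall fun n => (hmem n).integrable (by norm_num)) ?_ A⟩
  have hle : ∀ n, eLpNorm ((fun ω => Real.exp (X n ω)) - fun ω => Real.exp (Y ω)) 1 μ ≤
      eLpNorm (X n - Y) 2 μ * (C + C) := fun n => by
    have hsum : MemLp ((fun ω => Real.exp (X n ω)) + fun ω => Real.exp (Y ω)) 2 μ :=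
      (hmem n).add hYmem
    calc _ ≤ eLpNorm (fun ω => (X n - Y) ω *
          ((fun ω => Real.exp (X n ω)) + fun ω => Real.exp (Y ω)) ω) 1 μ := by
          refine eLpNorm_mono fun ω => ?_
          simp only [Pi.sub_apply, Pi.add_apply, norm_mul, Real.norm_eq_abs]
          rw [abs_of_pos (add_pos (Real.exp_pos (X n ω)) (Real.exp_pos (Y ω)))]
          exact abs_exp_sub_exp_le _ _
      _ ≤ (1 : ℝ≥0) * eLpNorm (X n - Y) 2 μ *
          eLpNorm ((fun ω => Real.exp (X n ω)) + fun ω => Real.exp (Y ω)) 2 μ :=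
          eLpNorm_le_eLpNorm_mul_eLpNorm'_of_norm ((hX n).sub hY).1 hsum.1 (fun a b => a * b) 1
            (Eventually.of_forall fun ω => by simp)
      _ ≤ _ := by
          rw [ENNReal.coe_one, one_mul]
          gcongr
          exact (eLpNorm_add_le (hmem n).1 hYm (by norm_num)).trans (add_le_add (hbd n) hYbd)
  refine tendsto_of_tendsto_of_tendsto_of_le_of_le tendsto_const_nhds ?_ (fun _ => zero_le) hle
  have := ENNReal.Tendsto.mul_const (b := C + C) hlim (Or.inr (by simp [hC]))
  simpa using this

end L2

/-! ### Itô isometry for step functions and uniqueness of the Wiener integral -/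

section Step

variable {Ω : Type*} {m : MeasurableSpace Ω} {Q : Measure Ω} {Z : ℝ≥0 → Ω → ℝ}

lemma memLp_stepFun {n : ℕ} (a b : Fin n → ℝ≥0) (c : Fin n → ℝ) :
    MemLp (stepFun a b c) 2 volume := by
  refine memLp_finsetSum _ fun i _ => ?_
  exact memLp_indicator_const 2 measurableSet_Ioc _ (Or.inr (by simp))

lemma memLp_brownian (hZ : IsPreBrownianReal Z Q) (t : ℝ≥0) : MemLp (Z t) 2 Q :=
  (hZ.isGaussianProcess.hasGaussianLaw_eval t).memLp_two

lemma memLp_stepIntegral (hZ : IsPreBrownianReal Z Q) {n : ℕ} (a b : Fin n → ℝ≥0)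
    (c : Fin n → ℝ) : MemLp (stepIntegral Z a b c) 2 Q :=
  memLp_finsetSum _ fun _ _ => ((memLp_brownian hZ _).sub (memLp_brownian hZ _)).const_mul _

lemma integral_brownian_mul (hZ : IsPreBrownianReal Z Q) (s t : ℝ≥0) :
    ∫ ω, Z s ω * Z t ω ∂Q = min (s : ℝ) t := by
  have : IsProbabilityMeasure Q := hZ.isGaussianProcess.isProbabilityMeasure
  have h := hZ.covariance_eval s t
  rw [covariance_eq_sub (memLp_brownian hZ s) (memLp_brownian hZ t), hZ.integral_eval] at h
  simpa using h

/-- The left side is the covariance of two Brownian increments; the right side is the length of the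
overlap of their intervals. -/
lemma min_combination_eq_max {a b a' b' : ℝ} (h : a ≤ b) (h' : a' ≤ b') :
    min b b' - min b a' - min a b' + min a a' = max 0 (min b b' - max a a') := by
  rcases le_total b b' with h1 | h1 <;> rcases le_total b a' with h2 | h2 <;>
    rcases le_total a b' with h3 | h3 <;> rcases le_total a a' with h4 | h4 <;>
    simp only [h1, h2, h3, h4, min_eq_left, min_eq_right, max_eq_left, max_eq_right] <;>
    first
      | (rw [max_eq_left (by linarith)]; linarith)
      | (rw [max_eq_right (by linarith)]; linarith)

lemma integral_increment_mul (hZ : IsPreBrownianReal Z Q) {a b a' b' : ℝ≥0} (h : a ≤ b)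
    (h' : a' ≤ b') :
    ∫ ω, (Z b ω - Z a ω) * (Z b' ω - Z a' ω) ∂Q = max 0 (min (b : ℝ) b' - max (a : ℝ) a') := by
  have hint : ∀ s t, Integrable (fun ω => Z s ω * Z t ω) Q := fun s t =>
    (memLp_brownian hZ s).integrable_mul (memLp_brownian hZ t)
  have : ∫ ω, (Z b ω - Z a ω) * (Z b' ω - Z a' ω) ∂Q =
      ∫ ω, ((Z b ω * Z b' ω - Z b ω * Z a' ω) - (Z a ω * Z b' ω - Z a ω * Z a' ω)) ∂Q := by
    congr 1; ext ω; ring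
  have hsub : ∀ s t t', Integrable (fun ω => Z s ω * Z t ω - Z s ω * Z t' ω) Q :=
    fun s t t' => (hint s t).sub (hint s t')
  rw [this, integral_sub (hsub _ _ _) (hsub _ _ _),
    integral_sub (hint _ _) (hint _ _), integral_sub (hint _ _) (hint _ _)]
  simp only [integral_brownian_mul hZ]
  rw [← min_combination_eq_max (by exact_mod_cast h) (by exact_mod_cast h')]
  ring

lemma integral_indicator_mul_indicator (a b a' b' c c' : ℝ) :
    ∫ u, (Ioc a b).indicator (fun _ => c) u * (Ioc a' b').indicator (fun _ => c') u =
      c * c' * max 0 (min b b' - max a a') := by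
  have : (fun u => (Ioc a b).indicator (fun _ => c) u * (Ioc a' b').indicator (fun _ => c') u)
      = (Ioc (max a a') (min b b')).indicator fun _ => c * c' := by
    ext u
    rw [← Ioc_inter_Ioc, Set.inter_indicator_mul]
  rw [this, integral_indicator_const _ measurableSet_Ioc, smul_eq_mul, mul_comm]
  congr 1
  rw [measureReal_def, Real.volume_Ioc, ENNReal.toReal_ofReal', max_comm]

lemma integral_stepFun_sq {n : ℕ} (a b : Fin n → ℝ≥0) (c : Fin n → ℝ) :
    ∫ u, stepFun a b c u ^ 2 =
      ∑ i, ∑ j, c i * c j * max 0 (min (b i : ℝ) (b j) - max (a i : ℝ) (a j)) := by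
  have hint : ∀ i j, Integrable (fun u => (Ioc (a i : ℝ) (b i : ℝ)).indicator (fun _ => c i) u *
      (Ioc (a j : ℝ) (b j : ℝ)).indicator (fun _ => c j) u) := fun i j =>
    (memLp_indicator_const 2 measurableSet_Ioc (c i) (Or.inr (by simp))).integrable_mul
      (memLp_indicator_const 2 measurableSet_Ioc (c j) (Or.inr (by simp)))
  simp_rw [stepFun, sq, Finset.sum_mul_sum]
  rw [integral_finsetSum _ fun i _ => integrable_finsetSum _ fun j _ => hint i j]
  refine Finset.sum_congr rfl fun i _ => ?_
  rw [integral_finsetSum _ fun j _ => hint i j]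
  exact Finset.sum_congr rfl fun j _ => integral_indicator_mul_indicator _ _ _ _ _ _

/-- The Itô isometry for step functions. -/
lemma integral_stepIntegral_sq (hZ : IsPreBrownianReal Z Q) {n : ℕ} {a b : Fin n → ℝ≥0}
    (c : Fin n → ℝ) (hab : ∀ i, a i ≤ b i) :
    ∫ ω, stepIntegral Z a b c ω ^ 2 ∂Q = ∫ u, stepFun a b c u ^ 2 := by
  have hm : ∀ i, MemLp (fun ω => c i * (Z (b i) ω - Z (a i) ω)) 2 Q := fun i =>
    ((memLp_brownian hZ _).sub (memLp_brownian hZ _)).const_mul _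
  have hint : ∀ i j, Integrable (fun ω => c i * (Z (b i) ω - Z (a i) ω) *
      (c j * (Z (b j) ω - Z (a j) ω))) Q := fun i j => (hm i).integrable_mul (hm j)
  rw [integral_stepFun_sq]
  simp_rw [stepIntegral, sq, Finset.sum_mul_sum]
  rw [integral_finsetSum _ fun i _ => integrable_finsetSum _ fun j _ => hint i j]
  refine Finset.sum_congr rfl fun i _ => ?_
  rw [integral_finsetSum _ fun j _ => hint i j]
  refine Finset.sum_congr rfl fun j _ => ?_
  rw [← integral_increment_mul hZ (hab i) (hab j), ← integral_const_mul]
  congr 1; ext ω; ring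

lemma eLpNorm_stepIntegral (hZ : IsPreBrownianReal Z Q) {n : ℕ} {a b : Fin n → ℝ≥0}
    (c : Fin n → ℝ) (hab : ∀ i, a i ≤ b i) :
    eLpNorm (stepIntegral Z a b c) 2 Q = eLpNorm (stepFun a b c) 2 volume := by
  rw [eLpNorm_two_eq_sqrt_integral_sq (memLp_stepIntegral hZ a b c),
    eLpNorm_two_eq_sqrt_integral_sq (memLp_stepFun a b c), integral_stepIntegral_sq hZ c hab]

/-- Concatenating the data adds step functions. Since intervals may overlap, no common refinement is
ever needed. -/
lemma stepFun_append {n k : ℕ} (a b : Fin n → ℝ≥0) (c : Fin n → ℝ) (a' b' : Fin k → ℝ≥0)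
    (c' : Fin k → ℝ) (u : ℝ) :
    stepFun (Fin.append a a') (Fin.append b b') (Fin.append c c') u =
      stepFun a b c u + stepFun a' b' c' u := by
  simp [stepFun, Fin.sum_univ_add]

lemma stepIntegral_append {n k : ℕ} (a b : Fin n → ℝ≥0) (c : Fin n → ℝ) (a' b' : Fin k → ℝ≥0)
    (c' : Fin k → ℝ) (ω : Ω) :
    stepIntegral Z (Fin.append a a') (Fin.append b b') (Fin.append c c') ω =
      stepIntegral Z a b c ω + stepIntegral Z a' b' c' ω := by
  simp [stepIntegral, Fin.sum_univ_add]

lemma append_le_append {n k : ℕ} {a b : Fin n → ℝ≥0} {a' b' : Fin k → ℝ≥0}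
    (h : ∀ i, a i ≤ b i) (h' : ∀ i, a' i ≤ b' i) (i : Fin (n + k)) :
    Fin.append a a' i ≤ Fin.append b b' i := by
  refine Fin.addCases (fun i => ?_) (fun i => ?_) i
  · simpa using h i
  · simpa using h' i

lemma stepFun_neg {n : ℕ} (a b : Fin n → ℝ≥0) (c : Fin n → ℝ) (u : ℝ) :
    stepFun a b (fun i => -c i) u = -stepFun a b c u := by
  simp only [stepFun, ← Finset.sum_neg_distrib]
  refine Finset.sum_congr rfl fun i _ => ?_
  by_cases hu : u ∈ Ioc (a i : ℝ) (b i) <;> simp [hu]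

lemma stepIntegral_neg {n : ℕ} (a b : Fin n → ℝ≥0) (c : Fin n → ℝ) (ω : Ω) :
    stepIntegral Z a b (fun i => -c i) ω = -stepIntegral Z a b c ω := by
  simp [stepIntegral]

/-- The Itô isometry for the difference of two step functions. -/
lemma eLpNorm_stepIntegral_sub (hZ : IsPreBrownianReal Z Q) {n k : ℕ} {a b : Fin n → ℝ≥0}
    {a' b' : Fin k → ℝ≥0} (c : Fin n → ℝ) (c' : Fin k → ℝ) (hab : ∀ i, a i ≤ b i)
    (hab' : ∀ i, a' i ≤ b' i) :
    eLpNorm (fun ω => stepIntegral Z a b c ω - stepIntegral Z a' b' c' ω) 2 Q =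
      eLpNorm (fun u => stepFun a b c u - stepFun a' b' c' u) 2 volume := by
  have h := eLpNorm_stepIntegral hZ (Fin.append c fun i => -c' i) (append_le_append hab hab')
  convert h using 2
  · ext ω; rw [stepIntegral_append, stepIntegral_neg, sub_eq_add_neg]
  · ext u; rw [stepFun_append, stepFun_neg, sub_eq_add_neg]

lemma IsWienerIntegral.congr_ae {f g : ℝ → ℝ} {X : Ω → ℝ} (hX : IsWienerIntegral Q Z f X)
    (hfg : f =ᵐ[volume] g) : IsWienerIntegral Q Z g X := by
  refine ⟨hX.1, fun ε hε => ?_⟩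
  obtain ⟨n, a, b, c, hab, h1, h2⟩ := hX.2 ε hε
  refine ⟨n, a, b, c, hab, ?_, h2⟩
  rwa [eLpNorm_congr_ae (g := fun u => f u - stepFun a b c u)]
  filter_upwards [hfg] with u hu
  rw [hu]

lemma IsWienerIntegral.add {f g : ℝ → ℝ} {X Y : Ω → ℝ} (hZ : IsPreBrownianReal Z Q)
    (hf : AEStronglyMeasurable f volume) (hg : AEStronglyMeasurable g volume)
    (hX : IsWienerIntegral Q Z f X) (hY : IsWienerIntegral Q Z g Y) :
    IsWienerIntegral Q Z (fun u => f u + g u) (fun ω => X ω + Y ω) := by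
  refine ⟨hX.1.add hY.1, fun ε hε => ?_⟩
  obtain ⟨n, a, b, c, hab, h1, h2⟩ := hX.2 (ε / 2) (ENNReal.half_pos hε.ne')
  obtain ⟨k, a', b', c', hab', h1', h2'⟩ := hY.2 (ε / 2) (ENNReal.half_pos hε.ne')
  refine ⟨n + k, Fin.append a a', Fin.append b b', Fin.append c c', append_le_append hab hab',
    ?_, ?_⟩
  · calc _ = eLpNorm ((fun u => f u - stepFun a b c u) + fun u => g u - stepFun a' b' c' u) 2
          volume := by
          congr 1; ext u; simp only [stepFun_append, Pi.add_apply]; ring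
      _ ≤ _ := eLpNorm_add_le (hf.sub (memLp_stepFun a b c).1)
          (hg.sub (memLp_stepFun a' b' c').1) (by norm_num)
      _ < ε / 2 + ε / 2 := ENNReal.add_lt_add h1 h1'
      _ = ε := ENNReal.add_halves ε
  · calc _ = eLpNorm ((fun ω => X ω - stepIntegral Z a b c ω) +
          fun ω => Y ω - stepIntegral Z a' b' c' ω) 2 Q := by
          congr 1; ext u; simp only [stepIntegral_append, Pi.add_apply]; ring
      _ ≤ _ := eLpNorm_add_le (hX.1.1.sub (memLp_stepIntegral hZ a b c).1)
          (hY.1.1.sub (memLp_stepIntegral hZ a' b' c').1) (by norm_num)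
      _ < ε / 2 + ε / 2 := ENNReal.add_lt_add h2 h2'
      _ = ε := ENNReal.add_halves ε

/-- The Wiener integral is unique up to null sets. -/
lemma IsWienerIntegral.ae_eq {f : ℝ → ℝ} {X Y : Ω → ℝ} (hZ : IsPreBrownianReal Z Q)
    (hf : AEStronglyMeasurable f volume)
    (hX : IsWienerIntegral Q Z f X) (hY : IsWienerIntegral Q Z f Y) : X =ᵐ[Q] Y := by
  have key : eLpNorm (X - Y) 2 Q = 0 := by
    refine le_antisymm (ENNReal.le_of_forall_pos_le_add fun δ hδ _ => ?_) zero_le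
    -- Four errors arise: `X` and `Y` against their step integrals, and, through the isometry, `f`
    -- against each of the two step functions.
    have hε : (0 : ℝ≥0∞) < δ / 4 := by
      rw [ENNReal.div_pos_iff]; exact ⟨by exact_mod_cast hδ.ne', by norm_num⟩
    obtain ⟨n, a, b, c, hab, h1, h2⟩ := hX.2 _ hε
    obtain ⟨k, a', b', c', hab', h1', h2'⟩ := hY.2 _ hε
    have hI := (memLp_stepIntegral hZ a b c).1
    have hI' := (memLp_stepIntegral hZ a' b' c').1
    have hφ := (memLp_stepFun a b c).1
    have hφ' := (memLp_stepFun a' b' c').1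
    have hmid : eLpNorm (fun ω => stepIntegral Z a b c ω - stepIntegral Z a' b' c' ω) 2 Q ≤
        δ / 4 + δ / 4 := by
      rw [eLpNorm_stepIntegral_sub hZ c c' hab hab']
      calc _ = eLpNorm ((fun u => f u - stepFun a' b' c' u) - fun u => f u - stepFun a b c u) 2
            volume := by
            congr 1; ext u; simp only [Pi.sub_apply]; ring
        _ ≤ _ := eLpNorm_sub_le (hf.sub hφ') (hf.sub hφ) (by norm_num)
        _ ≤ _ := add_le_add h1'.le h1.le
    calc eLpNorm (X - Y) 2 Q = eLpNorm (((fun ω => X ω - stepIntegral Z a b c ω) -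
          fun ω => Y ω - stepIntegral Z a' b' c' ω) +
          fun ω => stepIntegral Z a b c ω - stepIntegral Z a' b' c' ω) 2 Q := by
          congr 1; ext u; simp only [Pi.sub_apply, Pi.add_apply]; ring
      _ ≤ eLpNorm ((fun ω => X ω - stepIntegral Z a b c ω) -
          fun ω => Y ω - stepIntegral Z a' b' c' ω) 2 Q + (δ / 4 + δ / 4) :=
          (eLpNorm_add_le ((hX.1.1.sub hI).sub (hY.1.1.sub hI')) (hI.sub hI') (by norm_num)).trans
            (add_le_add le_rfl hmid)
      _ ≤ (δ / 4 + δ / 4) + (δ / 4 + δ / 4) := by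
          gcongr
          exact (eLpNorm_sub_le (hX.1.1.sub hI) (hY.1.1.sub hI') (by norm_num)).trans
            (add_le_add h2.le h2'.le)
      _ = (0 : ℝ≥0∞) + δ := by
          have h4 : (δ : ℝ≥0∞) / 4 + δ / 4 = δ / 2 := by
            rw [← ENNReal.add_div, ← two_mul, show (4 : ℝ≥0∞) = 2 * 2 by norm_num]
            exact ENNReal.mul_div_mul_left _ _ (by norm_num) (by norm_num)
          rw [h4, ENNReal.add_halves, zero_add]
  rw [eLpNorm_eq_zero_iff (hX.1.1.sub hY.1.1) (by norm_num)] at key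
  filter_upwards [key] with ω hω
  exact sub_eq_zero.1 hω

/-- Once some version has been constructed, the default value `0` is not taken and the chosen
version may be replaced by the constructed one. -/
lemma wienerIntegral_ae_eq {f : ℝ → ℝ} {X : Ω → ℝ} (hZ : IsPreBrownianReal Z Q)
    (hf : AEStronglyMeasurable f volume) (hX : IsWienerIntegral Q Z f X) :
    wienerIntegral Q Z f =ᵐ[Q] X := by
  have h : ∃ X : Ω → ℝ, IsWienerIntegral Q Z f X := ⟨X, hX⟩
  rw [wienerIntegral, dif_pos h]
  exact h.choose_spec.ae_eq hZ hf hX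

end Step

/-! ### Left endpoint approximation of monotone functions -/

section Partition

/-- The step function taking the value `c k` on `(s k, s (k + 1)]`, `k < N`. -/
def partitionFun (s : ℕ → ℝ≥0) (c : ℕ → ℝ) (N : ℕ) : ℝ → ℝ :=
  stepFun (fun i : Fin N => s i) (fun i : Fin N => s (i + 1)) (fun i : Fin N => c i)

lemma exists_mem_Ioc_succ {s : ℕ → ℝ≥0} {N : ℕ} {u : ℝ} (hu : u ∈ Ioc (s 0 : ℝ) (s N)) :
    ∃ k < N, u ∈ Ioc (s k : ℝ) (s (k + 1)) := by
  induction N with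
  | zero => exact absurd (hu.1.trans_le hu.2) (lt_irrefl _)
  | succ N ih =>
    by_cases h : u ≤ s N
    · obtain ⟨k, hk, hk'⟩ := ih ⟨hu.1, h⟩
      exact ⟨k, by omega, hk'⟩
    · exact ⟨N, by omega, not_le.1 h, hu.2⟩

lemma partitionFun_of_mem {s : ℕ → ℝ≥0} (hs : Monotone s) (c : ℕ → ℝ) {N k : ℕ} (hk : k < N)
    {u : ℝ} (hu : u ∈ Ioc (s k : ℝ) (s (k + 1))) : partitionFun s c N u = c k := by
  rw [partitionFun, stepFun, Finset.sum_eq_single (⟨k, hk⟩ : Fin N)]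
  · simp only [indicator_of_mem hu]
  · intro j _ hj
    refine indicator_of_notMem (fun hu' => hj ?_) _
    ext
    rcases lt_trichotomy (j : ℕ) k with h | h | h
    · have : (s (j + 1) : ℝ) ≤ s k := by exact_mod_cast hs h
      linarith [hu'.2, hu.1]
    · exact h
    · have : (s (k + 1) : ℝ) ≤ s j := by exact_mod_cast hs h
      linarith [hu'.1, hu.2]
  · simp

lemma partitionFun_of_notMem {s : ℕ → ℝ≥0} (hs : Monotone s) (c : ℕ → ℝ) {N : ℕ} {u : ℝ}
    (hu : u ∉ Ioc (s 0 : ℝ) (s N)) : partitionFun s c N u = 0 := by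
  rw [partitionFun, stepFun]
  refine Finset.sum_eq_zero fun j _ => indicator_of_notMem (fun hu' => hu ?_) _
  have h1 : (s 0 : ℝ) ≤ s j := by exact_mod_cast hs (Nat.zero_le _)
  have h2 : (s (j + 1) : ℝ) ≤ s N := by exact_mod_cast hs j.2
  exact ⟨h1.trans_lt hu'.1, hu'.2.trans h2⟩

/-- The intervals of a partition are disjoint, so only the diagonal of the double sum survives. -/
lemma integral_partitionFun_sq {s : ℕ → ℝ≥0} (hs : Monotone s) (c : ℕ → ℝ) (N : ℕ) :
    ∫ u, partitionFun s c N u ^ 2 =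
      ∑ k ∈ Finset.range N, c k ^ 2 * ((s (k + 1) : ℝ) - s k) := by
  rw [partitionFun, integral_stepFun_sq, ← Fin.sum_univ_eq_sum_range
    (fun k => c k ^ 2 * ((s (k + 1) : ℝ) - s k))]
  have hs' : ∀ {i j : ℕ}, i ≤ j → (s i : ℝ) ≤ s j := fun h => by exact_mod_cast hs h
  refine Finset.sum_congr rfl fun i _ => ?_
  rw [Finset.sum_eq_single i]
  · rw [min_self, max_self, max_eq_right (sub_nonneg.2 (hs' (Nat.le_succ _)))]
    ring
  · intro j _ hj
    rw [max_eq_left, mul_zero]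
    rcases lt_or_gt_of_ne hj with h | h
    · have h1 := hs' (Nat.succ_le_of_lt (Fin.lt_def.1 h))
      linarith [min_le_right (s (i + 1) : ℝ) (s (j + 1)), le_max_left (s i : ℝ) (s j)]
    · have h1 := hs' (Nat.succ_le_of_lt (Fin.lt_def.1 h))
      linarith [min_le_left (s (i + 1) : ℝ) (s (j + 1)), le_max_right (s i : ℝ) (s j)]
  · simp

/-- The uniform partition of `[p, p + h]` into `n + 1` intervals. -/
def uniformPartition (p h : ℝ≥0) (n k : ℕ) : ℝ≥0 := p + k / (n + 1) * h

lemma uniformPartition_mono (p h : ℝ≥0) (n : ℕ) : Monotone (uniformPartition p h n) := by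
  intro i j hij
  unfold uniformPartition
  gcongr

lemma uniformPartition_zero (p h : ℝ≥0) (n : ℕ) : uniformPartition p h n 0 = p := by
  simp [uniformPartition]

lemma uniformPartition_last (p h : ℝ≥0) (n : ℕ) : uniformPartition p h n (n + 1) = p + h := by
  have : (n : ℝ≥0) + 1 ≠ 0 := by positivity
  simp [uniformPartition, this]

lemma uniformPartition_succ_sub (p h : ℝ≥0) (n k : ℕ) :
    (uniformPartition p h n (k + 1) : ℝ) - uniformPartition p h n k = h / (n + 1) := by
  simp only [uniformPartition]
  push_cast
  ring

/-- The approximation of a function on `(p, p + h]` by its values at the left endpoints of the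
uniform partition. -/
def leftApprox (g : ℝ → ℝ) (p h : ℝ≥0) (n : ℕ) : ℝ → ℝ :=
  partitionFun (uniformPartition p h n) (fun k => g (uniformPartition p h n k)) (n + 1)

lemma leftApprox_of_notMem (g : ℝ → ℝ) {p h : ℝ≥0} (n : ℕ) {u : ℝ}
    (hu : u ∉ Ioc (p : ℝ) (p + h)) : leftApprox g p h n u = 0 := by
  refine partitionFun_of_notMem (uniformPartition_mono p h n) _ ?_
  rw [uniformPartition_zero, uniformPartition_last]
  simpa using hu

lemma exists_leftApprox_eq (g : ℝ → ℝ) {p h : ℝ≥0} (n : ℕ) {u : ℝ}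
    (hu : u ∈ Ioc (p : ℝ) (p + h)) :
    ∃ x : ℝ, (p : ℝ) ≤ x ∧ x < u ∧ u - x ≤ h / (n + 1) ∧ leftApprox g p h n u = g x := by
  obtain ⟨k, hk, hku⟩ := exists_mem_Ioc_succ (s := uniformPartition p h n) (N := n + 1) (u := u)
    (by rw [uniformPartition_zero, uniformPartition_last]; simpa using hu)
  refine ⟨uniformPartition p h n k, ?_, hku.1, ?_,
    partitionFun_of_mem (uniformPartition_mono p h n) _ hk hku⟩
  · have := uniformPartition_mono p h n (Nat.zero_le k)
    rw [uniformPartition_zero] at this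
    exact_mod_cast this
  · rw [← uniformPartition_succ_sub p h n k]
    linarith [hku.2]

/-- The hypotheses on a function on `(p, p + h]` under which left endpoint sums converge to it
from below. -/
structure IsLeftApproximable (g : ℝ → ℝ) (p h : ℝ≥0) : Prop where
  nonneg : ∀ x ∈ Ico (p : ℝ) (p + h), 0 ≤ g x
  monotoneOn : MonotoneOn g (Ico (p : ℝ) (p + h))
  continuousOn : ContinuousOn g (Ico (p : ℝ) (p + h))
  memLp : MemLp ((Ioc (p : ℝ) (p + h)).indicator g) 2 volume

variable {g : ℝ → ℝ} {p h : ℝ≥0}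

/-- A nondecreasing function is at least its value at the left end of each cell, so `g` itself
serves as the dominating function. -/
lemma IsLeftApproximable.leftApprox_mem_Icc (hg : IsLeftApproximable g p h) (n : ℕ) :
    ∀ᵐ u : ℝ, 0 ≤ leftApprox g p h n u ∧
      leftApprox g p h n u ≤ (Ioc (p : ℝ) (p + h)).indicator g u := by
  -- The right endpoint is discarded as a null set: when `p + h = t` the kernel is singular there,
  -- and its Lean value `0` breaks monotonicity.
  have hne : ∀ᵐ u : ℝ, u ≠ p + h := by simp [ae_iff]
  filter_upwards [hne] with u hu
  by_cases hmem : u ∈ Ioc (p : ℝ) (p + h)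
  · obtain ⟨x, hpx, hxu, -, hx⟩ := exists_leftApprox_eq g n hmem
    have huq : u < p + h := lt_of_le_of_ne hmem.2 hu
    rw [hx, indicator_of_mem hmem]
    exact ⟨hg.nonneg x ⟨hpx, hxu.trans huq⟩,
      hg.monotoneOn ⟨hpx, hxu.trans huq⟩ ⟨hmem.1.le, huq⟩ hxu.le⟩
  · rw [leftApprox_of_notMem g n hmem, indicator_of_notMem hmem]
    simp

lemma IsLeftApproximable.tendsto_leftApprox (hg : IsLeftApproximable g p h) :
    ∀ᵐ u : ℝ, Tendsto (fun n => leftApprox g p h n u) atTop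
      (𝓝 ((Ioc (p : ℝ) (p + h)).indicator g u)) := by
  have hne : ∀ᵐ u : ℝ, u ≠ p + h := by simp [ae_iff]
  filter_upwards [hne] with u hu
  by_cases hmem : u ∈ Ioc (p : ℝ) (p + h)
  · choose x hpx hxu hxh hx using fun n => exists_leftApprox_eq g (h := h) n hmem
    have huq : u < p + h := lt_of_le_of_ne hmem.2 hu
    simp_rw [hx, indicator_of_mem hmem]
    refine (hg.continuousOn u ⟨hmem.1.le, huq⟩).tendsto.comp (tendsto_nhdsWithin_iff.2 ⟨?_, ?_⟩)
    · have h0 : Tendsto (fun n : ℕ => u - (h : ℝ) / (n + 1)) atTop (𝓝 (u - 0)) := by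
        refine tendsto_const_nhds.sub ?_
        simpa [div_eq_mul_inv] using
        (tendsto_one_div_add_atTop_nhds_zero_nat (𝕜 := ℝ)).const_mul (h : ℝ)
      rw [sub_zero] at h0
      exact tendsto_of_tendsto_of_tendsto_of_le_of_le h0 tendsto_const_nhds
        (fun n => by have := hxh n; simp only; linarith) (fun n => (hxu n).le)
    · exact Eventually.of_forall fun n => ⟨hpx n, (hxu n).trans huq⟩
  · simp_rw [leftApprox_of_notMem g _ hmem, indicator_of_notMem hmem]
    exact tendsto_const_nhds

lemma memLp_leftApprox (g : ℝ → ℝ) (p h : ℝ≥0) (n : ℕ) : MemLp (leftApprox g p h n) 2 volume :=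
  memLp_stepFun _ _ _

lemma IsLeftApproximable.tendsto_eLpNorm (hg : IsLeftApproximable g p h) :
    Tendsto (fun n => eLpNorm (leftApprox g p h n - (Ioc (p : ℝ) (p + h)).indicator g) 2 volume)
      atTop (𝓝 0) := by
  refine tendsto_eLpNorm_two_of_dominated (fun n => (memLp_leftApprox g p h n).1) hg.memLp
    (fun n => ?_) hg.memLp.1 hg.tendsto_leftApprox
  filter_upwards [hg.leftApprox_mem_Icc n] with u hu
  rw [Real.norm_eq_abs, abs_le]
  constructor <;> linarith [hu.1, hu.2]

lemma IsLeftApproximable.integral_sq_le (hg : IsLeftApproximable g p h) (n : ℕ) :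
    ∫ u, leftApprox g p h n u ^ 2 ≤ ∫ u, (Ioc (p : ℝ) (p + h)).indicator g u ^ 2 := by
  refine integral_mono_ae (memLp_leftApprox g p h n).integrable_sq hg.memLp.integrable_sq ?_
  filter_upwards [hg.leftApprox_mem_Icc n] with u hu
  exact pow_le_pow_left₀ hu.1 hu.2 2

lemma IsLeftApproximable.tendsto_integral_sq (hg : IsLeftApproximable g p h) :
    Tendsto (fun n => ∫ u, leftApprox g p h n u ^ 2) atTop
      (𝓝 (∫ u, (Ioc (p : ℝ) (p + h)).indicator g u ^ 2)) := by
  refine tendsto_integral_of_dominated_convergence _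
    (fun n => (memLp_leftApprox g p h n).1.pow 2) hg.memLp.integrable_sq (fun n => ?_) ?_
  · filter_upwards [hg.leftApprox_mem_Icc n] with u hu
    rw [norm_pow, Real.norm_of_nonneg hu.1]
    exact pow_le_pow_left₀ hu.1 hu.2 2
  · filter_upwards [hg.tendsto_leftApprox] with u hu
    exact hu.pow 2

end Partition

/-! ### Exponential moments and construction of the Wiener integral -/

section Exponential

variable {Ω : Type*} {m : MeasurableSpace Ω} {Q : Measure Ω} {ℱ : Filtration ℝ≥0 m}
  {Z : ℝ≥0 → Ω → ℝ}

lemma lintegral_exp_increment (hZ : IsBrownianWrt Z ℱ Q) {s t : ℝ≥0} (hst : s ≤ t) (c : ℝ) :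
    ∫⁻ ω, ENNReal.ofReal (Real.exp (c * (Z t ω - Z s ω))) ∂Q =
      ENNReal.ofReal (Real.exp (c ^ 2 * ((t : ℝ) - s) / 2)) := by
  have := hZ.isBrownian.isGaussianProcess.isProbabilityMeasure
  have hlaw := hZ.isBrownian.hasLaw_sub t s
  have hmgf := mgf_gaussianReal hlaw.map_eq c
  have hint : Integrable (fun ω => Real.exp (c * (Z t ω - Z s ω))) Q :=
    (mgf_pos_iff (X := Z t - Z s) (μ := Q) (t := c)|>.1 (by rw [hmgf]; exact Real.exp_pos _))
  rw [← ofReal_integral_eq_lintegral_ofReal hint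
    (Eventually.of_forall fun ω => (Real.exp_pos _).le)]
  have h2 : ∫ ω, Real.exp (c * (Z t ω - Z s ω)) ∂Q = mgf (Z t - Z s) Q c := rfl
  have hst' : (s : ℝ) ≤ t := by exact_mod_cast hst
  rw [h2, hmgf, coe_nndist, Real.dist_eq]
  have : |(t.1 : ℝ) - s.1| = (t : ℝ) - s := abs_of_nonneg (sub_nonneg.2 hst')
  rw [this]
  congr 2
  ring

lemma measurable_sum_increments (hZ : IsBrownianWrt Z ℱ Q) {s : ℕ → ℝ≥0} (hs : Monotone s)
    (c : ℕ → ℝ) (N : ℕ) :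
    Measurable[ℱ (s N)] fun ω => ∑ k ∈ Finset.range N, c k * (Z (s (k + 1)) ω - Z (s k) ω) := by
  refine Finset.measurable_fun_sum _ fun k hk => Measurable.const_mul (Measurable.sub ?_ ?_) _
  · exact (hZ.adapted _).mono (ℱ.mono (hs (Finset.mem_range.1 hk))) le_rfl
  · exact (hZ.adapted _).mono (ℱ.mono (hs (Finset.mem_range.1 hk).le)) le_rfl

/-- Peel off the last increment: it is independent of `ℱ (s N)`, which contains both `A` and the
preceding sum. Allowing any `A` in `ℱ (s 0)` later makes this a statement on conditional
expectations. Lower integrals avoid proving integrability beforehand. -/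
lemma lintegral_exp_partition (hZ : IsBrownianWrt Z ℱ Q) {s : ℕ → ℝ≥0} (hs : Monotone s)
    (c : ℕ → ℝ) {A : Set Ω} (hA : MeasurableSet[ℱ (s 0)] A) (N : ℕ) :
    ∫⁻ ω in A, ENNReal.ofReal (Real.exp
        (∑ k ∈ Finset.range N, c k * (Z (s (k + 1)) ω - Z (s k) ω))) ∂Q =
      Q A * ENNReal.ofReal (Real.exp
        ((∑ k ∈ Finset.range N, c k ^ 2 * ((s (k + 1) : ℝ) - s k)) / 2)) := by
  have hAm : MeasurableSet A := ℱ.le _ _ hA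
  induction N with
  | zero => simp
  | succ N ih =>
    have hind := (hZ.indep (s N) (s (N + 1)) (hs N.le_succ)).symm
    have hAN : MeasurableSet[ℱ (s N)] A := ℱ.mono (hs (Nat.zero_le N)) _ hA
    have hf : Measurable[ℱ (s N)] (A.indicator fun ω => ENNReal.ofReal (Real.exp
        (∑ k ∈ Finset.range N, c k * (Z (s (k + 1)) ω - Z (s k) ω)))) :=
      Measurable.indicator (ENNReal.measurable_ofReal.comp (Real.measurable_exp.comp
        (measurable_sum_increments hZ hs c N))) hAN
    have hg : Measurable[MeasurableSpace.comap (fun ω => Z (s (N + 1)) ω - Z (s N) ω) inferInstance]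
        (fun ω => ENNReal.ofReal (Real.exp (c N * (Z (s (N + 1)) ω - Z (s N) ω)))) :=
      Measurable.comp (g := fun x : ℝ => ENNReal.ofReal (Real.exp (c N * x))) (by fun_prop)
        (comap_measurable _)
    have hZm : ∀ t, Measurable (Z t) := fun t => (hZ.adapted t).mono (ℱ.le t) le_rfl
    have key := lintegral_mul_eq_lintegral_mul_lintegral_of_independent_measurableSpace
      (ℱ.le _) (((hZm _).sub (hZm _)).comap_le) hind hf hg
    rw [lintegral_indicator hAm, ih, lintegral_exp_increment hZ (hs N.le_succ), mul_assoc,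
      ← ENNReal.ofReal_mul (Real.exp_pos _).le, ← Real.exp_add] at key
    rw [Finset.sum_range_succ (fun k => c k ^ 2 * ((s (k + 1) : ℝ) - s k)), add_div, ← key,
      ← lintegral_indicator hAm]
    refine lintegral_congr fun ω => ?_
    by_cases hω : ω ∈ A
    · simp only [indicator_of_mem hω]
      rw [← ENNReal.ofReal_mul (Real.exp_pos _).le, ← Real.exp_add, Finset.sum_range_succ]
    · simp [indicator_of_notMem hω]

/-- The integral of `partitionFun s c N`. -/
def partitionIntegral (Z : ℝ≥0 → Ω → ℝ) (s : ℕ → ℝ≥0) (c : ℕ → ℝ) (N : ℕ) : Ω → ℝ :=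
  stepIntegral Z (fun i : Fin N => s i) (fun i : Fin N => s (i + 1)) (fun i : Fin N => c i)

lemma partitionIntegral_eq (s : ℕ → ℝ≥0) (c : ℕ → ℝ) (N : ℕ) (ω : Ω) :
    partitionIntegral Z s c N ω =
      ∑ k ∈ Finset.range N, c k * (Z (s (k + 1)) ω - Z (s k) ω) := by
  rw [partitionIntegral, stepIntegral,
    Fin.sum_univ_eq_sum_range (fun k => c k * (Z (s (k + 1)) ω - Z (s k) ω))]

lemma lintegral_exp_partitionIntegral (hZ : IsBrownianWrt Z ℱ Q) {s : ℕ → ℝ≥0} (hs : Monotone s)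
    (c : ℕ → ℝ) {A : Set Ω} (hA : MeasurableSet[ℱ (s 0)] A) (N : ℕ) (l : ℝ) :
    ∫⁻ ω in A, ENNReal.ofReal (Real.exp (l * partitionIntegral Z s c N ω)) ∂Q =
      Q A * ENNReal.ofReal (Real.exp (l ^ 2 / 2 * ∫ u, partitionFun s c N u ^ 2)) := by
  have h := lintegral_exp_partition hZ hs (fun k => l * c k) hA N
  have e : l ^ 2 / 2 * ∑ k ∈ Finset.range N, c k ^ 2 * ((s (k + 1) : ℝ) - s k) =
      (∑ k ∈ Finset.range N, (l * c k) ^ 2 * ((s (k + 1) : ℝ) - s k)) / 2 := by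
    rw [Finset.mul_sum, Finset.sum_div]
    exact Finset.sum_congr rfl fun k _ => by ring
  rw [integral_partitionFun_sq hs, e, ← h]
  refine lintegral_congr fun ω => ?_
  simp only [partitionIntegral_eq, Finset.mul_sum, mul_assoc]

lemma memLp_exp_partitionIntegral (hZ : IsBrownianWrt Z ℱ Q) {s : ℕ → ℝ≥0} (hs : Monotone s)
    (c : ℕ → ℝ) (N : ℕ) (l : ℝ) :
    MemLp (fun ω => Real.exp (l * partitionIntegral Z s c N ω)) 2 Q := by
  have := hZ.isBrownian.isGaussianProcess.isProbabilityMeasure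
  have hm : AEStronglyMeasurable (partitionIntegral Z s c N) Q :=
    (memLp_stepIntegral hZ.isBrownian.toIsPreBrownianReal _ _ _).1
  have hm2 : AEStronglyMeasurable (fun ω => Real.exp (l * partitionIntegral Z s c N ω)) Q :=
    Real.continuous_exp.comp_aestronglyMeasurable (hm.const_mul l)
  rw [memLp_two_iff_integrable_sq hm2]
  have h := lintegral_exp_partitionIntegral hZ hs c MeasurableSet.univ N (2 * l)
  refine ⟨hm2.pow 2, ?_⟩
  rw [hasFiniteIntegral_iff_ofReal (Eventually.of_forall fun ω => sq_nonneg _)]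
  have : ∀ ω, Real.exp (l * partitionIntegral Z s c N ω) ^ 2 =
      Real.exp (2 * l * partitionIntegral Z s c N ω) := fun ω => by
    rw [sq, ← Real.exp_add]; congr 1; ring
  simp_rw [this]
  rw [setLIntegral_univ] at h
  rw [h, measure_univ, one_mul]
  exact ENNReal.ofReal_lt_top

lemma setIntegral_exp_partitionIntegral (hZ : IsBrownianWrt Z ℱ Q) {s : ℕ → ℝ≥0} (hs : Monotone s)
    (c : ℕ → ℝ) {A : Set Ω} (hA : MeasurableSet[ℱ (s 0)] A) (N : ℕ) (l : ℝ) :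
    ∫ ω in A, Real.exp (l * partitionIntegral Z s c N ω) ∂Q =
      Q.real A * Real.exp (l ^ 2 / 2 * ∫ u, partitionFun s c N u ^ 2) := by
  have := hZ.isBrownian.isGaussianProcess.isProbabilityMeasure
  rw [integral_eq_lintegral_of_nonneg_ae (Eventually.of_forall fun ω => (Real.exp_pos _).le)
    (memLp_exp_partitionIntegral hZ hs c N l).1.restrict,
    lintegral_exp_partitionIntegral hZ hs c hA, ENNReal.toReal_mul,
    ENNReal.toReal_ofReal (Real.exp_pos _).le, measureReal_def]

lemma aestronglyMeasurable_partitionIntegral (hZ : IsBrownianWrt Z ℱ Q) {s : ℕ → ℝ≥0}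
    (hs : Monotone s) (c : ℕ → ℝ) (N : ℕ) :
    AEStronglyMeasurable[ℱ (s N)] (partitionIntegral Z s c N) Q := by
  have : Measurable[ℱ (s N)] (partitionIntegral Z s c N) := by
    rw [funext (partitionIntegral_eq (Z := Z) s c N)]
    exact measurable_sum_increments hZ hs c N
  exact this.stronglyMeasurable.aestronglyMeasurable

/-- Existence, measurability and exponential moments of the Wiener integral over `(p, p + h]`. -/
theorem IsLeftApproximable.exists_wienerIntegral (hZ : IsBrownianWrt Z ℱ Q) {g : ℝ → ℝ}
    {p h : ℝ≥0} (hg : IsLeftApproximable g p h) :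
    ∃ X : Ω → ℝ, IsWienerIntegral Q Z ((Ioc (p : ℝ) (p + h)).indicator g) X ∧
      AEStronglyMeasurable[ℱ (p + h)] X Q ∧
      ∀ l : ℝ, MemLp (fun ω => Real.exp (l * X ω)) 2 Q ∧
        ∀ A : Set Ω, MeasurableSet[ℱ p] A → ∫ ω in A, Real.exp (l * X ω) ∂Q =
          Q.real A * Real.exp (l ^ 2 / 2 * ∫ u, (Ioc (p : ℝ) (p + h)).indicator g u ^ 2) := by
  have hprob := hZ.isBrownian.isGaussianProcess.isProbabilityMeasure
  have hZ' := hZ.isBrownian.toIsPreBrownianReal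
  set G := (Ioc (p : ℝ) (p + h)).indicator g with hG
  set s := uniformPartition p h with hsdef
  have hs : ∀ n, Monotone (s n) := uniformPartition_mono p h
  let I : ℕ → Ω → ℝ := fun n => partitionIntegral Z (s n) (fun k => g (s n k)) (n + 1)
  have hI : ∀ n, MemLp (I n) 2 Q := fun n => memLp_stepIntegral hZ' _ _ _
  -- By the isometry, the integrals are as far apart in `L²(Q)` as their integrands in `L²(ℝ)`; the
  -- convergent integrands thus make the integrals Cauchy.
  have hdist : ∀ n k, dist ((hI n).toLp (I n)) ((hI k).toLp (I k)) =
      dist ((memLp_leftApprox g p h n).toLp _) ((memLp_leftApprox g p h k).toLp _) := by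
    intro n k
    rw [Lp.dist_def, Lp.dist_def]
    have e1 : eLpNorm (⇑((hI n).toLp (I n)) - ⇑((hI k).toLp (I k))) 2 Q =
        eLpNorm (fun ω => I n ω - I k ω) 2 Q :=
      eLpNorm_congr_ae ((hI n).coeFn_toLp.sub (hI k).coeFn_toLp)
    have e2 : eLpNorm (⇑((memLp_leftApprox g p h n).toLp _) -
        ⇑((memLp_leftApprox g p h k).toLp _)) 2 volume =
        eLpNorm (fun u => leftApprox g p h n u - leftApprox g p h k u) 2 volume :=
      eLpNorm_congr_ae ((memLp_leftApprox g p h n).coeFn_toLp.sub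
        (memLp_leftApprox g p h k).coeFn_toLp)
    rw [e1, e2]
    congr 1
    exact eLpNorm_stepIntegral_sub hZ' _ _ (fun i => hs n (Nat.le_succ _))
      (fun i => hs k (Nat.le_succ _))
  have hcauchy : CauchySeq fun n => (hI n).toLp (I n) := by
    have h1 := ((Lp.tendsto_Lp_iff_tendsto_eLpNorm'' _ (memLp_leftApprox g p h) _ hg.memLp).2
      hg.tendsto_eLpNorm).cauchySeq
    rw [Metric.cauchySeq_iff] at h1 ⊢
    simpa only [hdist] using h1
  obtain ⟨X, hXmem, hYm, hX⟩ : ∃ (X : Ω → ℝ) (hX : MemLp X 2 Q),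
      AEStronglyMeasurable[ℱ (p + h)] X Q ∧
      Tendsto (fun n => (hI n).toLp (I n)) atTop (𝓝 (hX.toLp X)) := by
    obtain ⟨Y, hY⟩ := cauchySeq_tendsto_of_complete hcauchy
    refine ⟨Y, Lp.memLp Y, ?_, by rwa [Lp.toLp_coeFn]⟩
    -- Measurability for `ℱ (p + h)`, up to null sets, is a closed condition in `L²`, and every
    -- approximation satisfies it.
    refine (isClosed_aestronglyMeasurable (p := 2) (μ := Q) (F := ℝ) (ℱ.le (p + h))).mem_of_tendsto
      hY (Eventually.of_forall fun n => ?_)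
    have h1 := aestronglyMeasurable_partitionIntegral hZ (hs n) (fun k => g (s n k)) (n + 1)
    rw [hsdef, uniformPartition_last] at h1
    exact h1.congr (hI n).coeFn_toLp.symm
  have hlim : Tendsto (fun n => eLpNorm (I n - X) 2 Q) atTop (𝓝 0) :=
    (Lp.tendsto_Lp_iff_tendsto_eLpNorm'' I hI X hXmem).1 hX
  refine ⟨X, ⟨hXmem, fun ε hε => ?_⟩, hYm, fun l => ?_⟩
  · obtain ⟨n, hn1, hn2⟩ := ((hlim.eventually_lt_const hε).and
      (hg.tendsto_eLpNorm.eventually_lt_const hε)).exists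
    refine ⟨n + 1, _, _, fun i => g (s n i), fun i => hs n (Nat.le_succ i), ?_, ?_⟩
    · rw [eLpNorm_sub_comm] at hn2
      exact hn2
    · rw [eLpNorm_sub_comm] at hn1
      exact hn1
  · have hlX : Tendsto (fun n => eLpNorm ((fun ω => l * I n ω) - fun ω => l * X ω) 2 Q) atTop
        (𝓝 0) := by
      have h1 : ∀ n, eLpNorm ((fun ω => l * I n ω) - fun ω => l * X ω) 2 Q =
          ‖l‖ₑ * eLpNorm (I n - X) 2 Q := fun n => by
        rw [← eLpNorm_const_smul]
        congr 1
        ext ω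
        simp [mul_sub]
      simp_rw [h1]
      have := ENNReal.Tendsto.const_mul (a := ‖l‖ₑ) hlim (Or.inr (by simp))
      simpa using this
    -- The square is the exponential with parameter `2l`; the bound is uniform in `n` because the
    -- approximations lie below `g`.
    have hsq : ∀ n, ∫ ω, Real.exp (l * I n ω) ^ 2 ∂Q ≤
        Real.exp ((2 * l) ^ 2 / 2 * ∫ u, G u ^ 2) := fun n => by
      have h1 := setIntegral_exp_partitionIntegral hZ (hs n) (fun k => g (s n k))
        MeasurableSet.univ (n + 1) (2 * l)
      have h2 : ∀ ω, Real.exp (l * I n ω) ^ 2 = Real.exp (2 * l * I n ω) := fun ω => by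
        rw [sq, ← Real.exp_add]; congr 1; ring
      simp_rw [h2]
      rw [setIntegral_univ, probReal_univ, one_mul] at h1
      rw [h1]
      exact Real.exp_le_exp.2 (mul_le_mul_of_nonneg_left (hg.integral_sq_le n) (by positivity))
    obtain ⟨hmem, htend⟩ := exp_moments_of_tendsto_eLpNorm (fun n => (hI n).const_mul l)
      (hXmem.const_mul l) hlX (fun n => memLp_exp_partitionIntegral hZ (hs n) _ _ l) hsq
    refine ⟨hmem, fun A hA => tendsto_nhds_unique (htend A) ?_⟩
    have h1 : ∀ n, ∫ ω in A, Real.exp (l * I n ω) ∂Q =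
        Q.real A * Real.exp (l ^ 2 / 2 * ∫ u, leftApprox g p h n u ^ 2) := fun n =>
      setIntegral_exp_partitionIntegral hZ (hs n) _ (by rwa [hsdef, uniformPartition_zero]) _ l
    simp_rw [h1]
    exact ((Real.continuous_exp.tendsto _).comp (hg.tendsto_integral_sq.const_mul _)).const_mul _

end Exponential

/-! ### The Volterra kernel and its covariance -/

section Kernel

lemma IsLeftApproximable.add {f g : ℝ → ℝ} {p h : ℝ≥0} (hf : IsLeftApproximable f p h)
    (hg : IsLeftApproximable g p h) : IsLeftApproximable (fun u => f u + g u) p h where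
  nonneg x hx := add_nonneg (hf.nonneg x hx) (hg.nonneg x hx)
  monotoneOn := hf.monotoneOn.add hg.monotoneOn
  continuousOn := hf.continuousOn.add hg.continuousOn
  memLp := by
    have := hf.memLp.add hg.memLp
    rwa [← indicator_add'] at this

variable {H t p q : ℝ}

lemma intervalIntegrable_sub_rpow (hH : 0 < H) :
    IntervalIntegrable (fun u => (t - u) ^ (2 * H - 1)) volume p q := by
  have := (intervalIntegral.intervalIntegrable_rpow' (a := t - p) (b := t - q)
    (r := 2 * H - 1) (by linarith)).comp_sub_left t
  simpa using this

lemma integral_sub_rpow (hH : 0 < H) :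
    ∫ u in p..q, (t - u) ^ (2 * H - 1) = ((t - p) ^ (2 * H) - (t - q) ^ (2 * H)) / (2 * H) := by
  rw [intervalIntegral.integral_comp_sub_left (fun x => x ^ (2 * H - 1)),
    integral_rpow (Or.inl (by linarith))]
  simp

lemma sq_sub_rpow {u : ℝ} (hu : u ≤ t) :
    ((t - u) ^ (H - 1 / 2)) ^ 2 = (t - u) ^ (2 * H - 1) := by
  rw [← Real.rpow_natCast, ← Real.rpow_mul (sub_nonneg.2 hu)]
  congr 1
  push_cast
  ring

/-- The square is `(t - u)^(2H - 1)`, whose exponent exceeds `-1` exactly because `H > 0`. -/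
lemma memLp_kernel (hH : 0 < H) (hpq : p ≤ q) (hqt : q ≤ t) :
    MemLp (fun u => (t - u) ^ (H - 1 / 2)) 2 (volume.restrict (Ioc p q)) := by
  have hm : AEStronglyMeasurable (fun u => (t - u) ^ (H - 1 / 2)) (volume.restrict (Ioc p q)) :=
    Measurable.aestronglyMeasurable (by fun_prop)
  rw [memLp_two_iff_integrable_sq hm]
  refine Integrable.congr
    ((intervalIntegrable_iff_integrableOn_Ioc_of_le hpq).1 (intervalIntegrable_sub_rpow (t := t) hH)) ?_
  filter_upwards [ae_restrict_mem measurableSet_Ioc] with u hu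
  exact (sq_sub_rpow (hu.2.trans hqt)).symm

/-- `H < 1/2` makes the exponent negative, hence the kernel increasing up to its singularity at `t`.
-/
lemma isLeftApproximable_kernel {p h : ℝ≥0} (hH0 : 0 < H) (hH : H < 1 / 2)
    (hqt : (p : ℝ) + h ≤ t) : IsLeftApproximable (fun u => (t - u) ^ (H - 1 / 2)) p h where
  nonneg x hx := Real.rpow_nonneg (by linarith [hx.2]) _
  monotoneOn x hx y hy hxy :=
    Real.rpow_le_rpow_of_nonpos (by linarith [hy.2]) (by linarith) (by linarith)
  continuousOn := ContinuousOn.rpow_const (by fun_prop) fun x hx => Or.inl (by linarith [hx.2])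
  memLp := by
    rw [memLp_indicator_iff_restrict measurableSet_Ioc]
    exact memLp_kernel hH0 (by simp) hqt

lemma integral_indicator_sq (f : ℝ → ℝ) (hpq : p ≤ q) :
    ∫ u, (Ioc p q).indicator f u ^ 2 = ∫ u in p..q, f u ^ 2 := by
  rw [intervalIntegral.integral_of_le hpq, ← integral_indicator measurableSet_Ioc]
  congr 1
  ext u
  by_cases hu : u ∈ Ioc p q <;> simp [hu]

lemma integral_kernel_sq (hH : 0 < H) (hpq : p ≤ q) (hqt : q ≤ t) :
    ∫ u, (Ioc p q).indicator (fun u => (t - u) ^ (H - 1 / 2)) u ^ 2 =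
      ((t - p) ^ (2 * H) - (t - q) ^ (2 * H)) / (2 * H) := by
  rw [integral_indicator_sq _ hpq, ← integral_sub_rpow hH]
  refine intervalIntegral.integral_congr fun u hu => ?_
  rw [uIcc_of_le hpq] at hu
  exact sq_sub_rpow (hu.2.trans hqt)

/-- `∫₀ᵀ (u - s)^{H₋} (t - s)^{H₋} ds`. -/
def kernelCov (H T u t : ℝ) : ℝ := ∫ s in (0 : ℝ)..T, (u - s) ^ (H - 1 / 2) * (t - s) ^ (H - 1 / 2)

lemma kernelCov_comm (H T u t : ℝ) : kernelCov H T u t = kernelCov H T t u := by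
  simp only [kernelCov, mul_comm]

lemma intervalIntegrable_kernel_sq {T : ℝ} (hH : 0 < H) (hT : 0 ≤ T) (hTt : T ≤ t) :
    IntervalIntegrable (fun s => ((t - s) ^ (H - 1 / 2)) ^ 2) volume 0 T :=
  (intervalIntegrable_iff_integrableOn_Ioc_of_le hT).2 (memLp_kernel hH hT hTt).integrable_sq

lemma intervalIntegrable_kernel_mul {T u : ℝ} (hH : 0 < H) (hT : 0 ≤ T) (hTt : T ≤ t)
    (hTu : T ≤ u) :
    IntervalIntegrable (fun s => (u - s) ^ (H - 1 / 2) * (t - s) ^ (H - 1 / 2)) volume 0 T :=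
  (intervalIntegrable_iff_integrableOn_Ioc_of_le hT).2
    ((memLp_kernel hH hT hTu).integrable_mul (memLp_kernel hH hT hTt))

lemma integral_kernel_sq' {T : ℝ} (hH : 0 < H) (hT : 0 ≤ T) (hTt : T ≤ t) :
    ∫ s in (0 : ℝ)..T, ((t - s) ^ (H - 1 / 2)) ^ 2 =
      (t ^ (2 * H) - (t - T) ^ (2 * H)) / (2 * H) := by
  rw [← integral_indicator_sq _ hT, integral_kernel_sq hH hT hTt, sub_zero]

lemma integral_kernel_add_sq {T u : ℝ} (hH : 0 < H) (hT : 0 ≤ T) (hTt : T ≤ t) (hTu : T ≤ u) :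
    ∫ s, (Ioc 0 T).indicator
        (fun s => (u - s) ^ (H - 1 / 2) + (t - s) ^ (H - 1 / 2)) s ^ 2 =
      (u ^ (2 * H) - (u - T) ^ (2 * H)) / (2 * H) + (t ^ (2 * H) - (t - T) ^ (2 * H)) / (2 * H)
        + 2 * kernelCov H T u t := by
  rw [integral_indicator_sq _ hT, ← integral_kernel_sq' hH hT hTt, ← integral_kernel_sq' hH hT hTu,
    kernelCov, ← intervalIntegral.integral_const_mul,
    ← intervalIntegral.integral_add (intervalIntegrable_kernel_sq hH hT hTu)
      (intervalIntegrable_kernel_sq hH hT hTt),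
    ← intervalIntegral.integral_add ((intervalIntegrable_kernel_sq hH hT hTu).add
      (intervalIntegrable_kernel_sq hH hT hTt))
      ((intervalIntegrable_kernel_mul hH hT hTt hTu).const_mul 2)]
  congr 1
  ext s
  ring

/-- By `2xy ≤ x² + y²` the covariance is at most the mean of two variances. The bound is uniform in
`u` and `t`, so `ξ₀(u) ξ₀(t)` dominates the second moment integrand up to a constant. -/
lemma kernelCov_le {T u B : ℝ} (hH : 0 < H) (hT : 0 ≤ T) (hTt : T ≤ t) (hTu : T ≤ u)
    (htB : t ≤ B) (huB : u ≤ B) : kernelCov H T u t ≤ B ^ (2 * H) / (2 * H) := by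
  have hsq : ∀ {x : ℝ}, T ≤ x → x ≤ B →
      ∫ s in (0 : ℝ)..T, ((x - s) ^ (H - 1 / 2)) ^ 2 ≤ B ^ (2 * H) / (2 * H) := by
    intro x hTx hxB
    rw [integral_kernel_sq' hH hT hTx]
    have h1 : x ^ (2 * H) ≤ B ^ (2 * H) := Real.rpow_le_rpow (by linarith) hxB (by linarith)
    have h2 : 0 ≤ (x - T) ^ (2 * H) := Real.rpow_nonneg (by linarith) _
    gcongr
    linarith
  have h : kernelCov H T u t ≤ ∫ s in (0 : ℝ)..T, (1 / 2) *
      (((u - s) ^ (H - 1 / 2)) ^ 2 + ((t - s) ^ (H - 1 / 2)) ^ 2) := by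
    refine intervalIntegral.integral_mono hT (intervalIntegrable_kernel_mul hH hT hTt hTu)
      (((intervalIntegrable_kernel_sq hH hT hTu).add
        (intervalIntegrable_kernel_sq hH hT hTt)).const_mul _) fun s => ?_
    have := two_mul_le_add_sq ((u - s) ^ (H - 1 / 2)) ((t - s) ^ (H - 1 / 2))
    simp only
    linarith
  rw [intervalIntegral.integral_const_mul, intervalIntegral.integral_add
    (intervalIntegrable_kernel_sq hH hT hTu) (intervalIntegrable_kernel_sq hH hT hTt)] at h
  linarith [hsq hTt htB, hsq hTu huB]

/-- The pure power terms of `theta` cancel the prefactor exactly, leaving `4ν²C_H²` times the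
covariance. -/
lemma exp_mul_exp_theta {ν T u : ℝ} (hH : 0 < H) (hT : 0 ≤ T) (hTt : T ≤ t) (htu : t < u) :
    Real.exp (ν ^ 2 * constC H ^ 2 / H *
        ((u - T) ^ (2 * H) + (t - T) ^ (2 * H) - u ^ (2 * H) - t ^ (2 * H))) *
      Real.exp (theta ν H T u t) = Real.exp ((2 * ν * constC H) ^ 2 * kernelCov H T u t) := by
  rw [← Real.exp_add, kernelCov, integral_sub_rpow_mul_sub_rpow hH hT hTt htu, theta]
  congr 1
  field_simp
  ring

/-- The diagonal is left out because `thetaBar` has only a conventional value there; it is a null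
set for the double integral. -/
lemma secondMomentIntegrand_eq {ν T : ℝ} {ξ₀ : ℝ → ℝ} (hH : 0 < H) (hT : 0 ≤ T) {P : ℝ × ℝ}
    (h1 : T ≤ P.1) (h2 : T ≤ P.2) (hne : P.1 ≠ P.2) :
    secondMomentIntegrand ξ₀ ν H T P =
      ξ₀ P.1 * ξ₀ P.2 * Real.exp ((2 * ν * constC H) ^ 2 * kernelCov H T P.1 P.2) := by
  rw [secondMomentIntegrand, thetaBar, if_neg hne, mul_assoc]
  congr 1
  rcases lt_or_gt_of_ne hne with h | h
  · rw [max_eq_right h.le, min_eq_left h.le, kernelCov_comm, ← exp_mul_exp_theta hH hT h1 h]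
    congr 2
    ring
  · rw [max_eq_left h.le, min_eq_right h.le, ← exp_mul_exp_theta hH hT h2 h]

end Kernel

/-! ### The forward variance and its moments -/

section Field

variable {Ω : Type*} {m : MeasurableSpace Ω} {Q : Measure Ω} {ℱ : Filtration ℝ≥0 m}
  {Z : ℝ≥0 → Ω → ℝ} {H : ℝ} {T : ℝ≥0}

/-- Conditional exponential moments of a Wiener integral over `(p, q]` given `ℱ p`. -/
lemma condExp_exp_eq {X : Ω → ℝ} {p : ℝ≥0} {l v : ℝ} [IsProbabilityMeasure Q]
    (hmem : MemLp (fun ω => Real.exp (l * X ω)) 2 Q)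
    (hX : ∀ A : Set Ω, MeasurableSet[ℱ p] A → ∫ ω in A, Real.exp (l * X ω) ∂Q = Q.real A * v) :
    Q[fun ω => Real.exp (l * X ω) | ℱ p] =ᵐ[Q] fun _ => v := by
  refine (ae_eq_condExp_of_forall_setIntegral_eq (ℱ.le p) (hmem.integrable (by norm_num))
    (fun s _ _ => integrableOn_const) (fun s hs _ => ?_)
    aestronglyMeasurable_const).symm
  rw [hX s hs, setIntegral_const, smul_eq_mul]

lemma exists_wienerIntegral_Ioc (hZ : IsBrownianWrt Z ℱ Q) {g : ℝ → ℝ}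
    {p q : ℝ≥0} (hpq : p ≤ q) (hg : IsLeftApproximable g p (q - p)) :
    ∃ X : Ω → ℝ, IsWienerIntegral Q Z ((Ioc (p : ℝ) q).indicator g) X ∧
      AEStronglyMeasurable[ℱ q] X Q ∧
      ∀ l : ℝ, MemLp (fun ω => Real.exp (l * X ω)) 2 Q ∧
        ∀ A : Set Ω, MeasurableSet[ℱ p] A → ∫ ω in A, Real.exp (l * X ω) ∂Q =
          Q.real A * Real.exp (l ^ 2 / 2 * ∫ u, (Ioc (p : ℝ) q).indicator g u ^ 2) := by
  have h := hg.exists_wienerIntegral hZ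
  rwa [add_tsub_cancel_of_le hpq, NNReal.coe_sub hpq, add_sub_cancel] at h

lemma exists_wienerIntegral_kernel (hZ : IsBrownianWrt Z ℱ Q) (hH0 : 0 < H) (hH : H < 1 / 2)
    {p q : ℝ≥0} (hpq : p ≤ q) {t : ℝ} (hqt : q ≤ t) :
    ∃ X : Ω → ℝ, IsWienerIntegral Q Z
        ((Ioc (p : ℝ) q).indicator fun u => (t - u) ^ (H - 1 / 2)) X ∧
      AEStronglyMeasurable[ℱ q] X Q ∧
      ∀ l : ℝ, MemLp (fun ω => Real.exp (l * X ω)) 2 Q ∧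
        ∀ A : Set Ω, MeasurableSet[ℱ p] A → ∫ ω in A, Real.exp (l * X ω) ∂Q =
          Q.real A * Real.exp (l ^ 2 / 2 *
            (((t - p) ^ (2 * H) - (t - q) ^ (2 * H)) / (2 * H))) := by
  have hg := isLeftApproximable_kernel (p := p) (h := q - p) (t := t) hH0 hH
    (by rw [NNReal.coe_sub hpq]; linarith)
  obtain ⟨X, h1, h2, h3⟩ := exists_wienerIntegral_Ioc hZ hpq hg
  rw [integral_kernel_sq hH0 (by exact_mod_cast hpq) hqt] at h3
  exact ⟨X, h1, h2, h3⟩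

lemma aestronglyMeasurable_kernel_indicator (H t p q : ℝ) :
    AEStronglyMeasurable ((Ioc p q).indicator fun u => (t - u) ^ (H - 1 / 2)) volume :=
  (Measurable.indicator (by fun_prop) measurableSet_Ioc).aestronglyMeasurable

/-- The forward variance in terms of the Wiener integral over `(0, T]`. -/
lemma condExp_instVariance (hZ : IsBrownianWrt Z ℱ Q) (hH0 : 0 < H) (hH : H < 1 / 2)
    (ν : ℝ) (ξ₀ : ℝ → ℝ) {t : ℝ} (hTt : T ≤ t) {X : Ω → ℝ}
    (hX : IsWienerIntegral Q Z
      ((Ioc (0 : ℝ) T).indicator fun u => (t - u) ^ (H - 1 / 2)) X)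
    (hXm : AEStronglyMeasurable[ℱ T] X Q) :
    Q[instVariance Q Z ξ₀ ν H t | ℱ T] =ᵐ[Q] fun ω => ξ₀ t * Real.exp
      (2 * ν * constC H * X ω
        - (2 * ν * constC H) ^ 2 / 2 * ((t ^ (2 * H) - (t - T) ^ (2 * H)) / (2 * H))) := by
  have hprob := hZ.isBrownian.isGaussianProcess.isProbabilityMeasure
  have hZ' := hZ.isBrownian.toIsPreBrownianReal
  have hT0 : (0 : ℝ) ≤ T := T.2
  lift t to ℝ≥0 using hT0.trans hTt
  have hTt' : T ≤ t := by exact_mod_cast hTt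
  set κ := 2 * ν * constC H
  -- `Y` is the part of the Volterra integral after `T` and `W` the whole of it. Uniqueness
  -- identifies `W` with both `volterra` and `X + Y`.
  obtain ⟨Y, hY, -, hYexp⟩ := exists_wienerIntegral_kernel hZ hH0 hH hTt' (le_refl (t : ℝ))
  obtain ⟨W, hW, -, hWexp⟩ := exists_wienerIntegral_kernel hZ hH0 hH (zero_le (a := t))
    (le_refl (t : ℝ))
  rw [NNReal.coe_zero] at hW
  obtain ⟨hYmem, hYint⟩ := hYexp κ
  have hVW : volterra Q Z H t =ᵐ[Q] W :=
    wienerIntegral_ae_eq hZ' (aestronglyMeasurable_kernel_indicator H t 0 t) hW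
  have hWXY : W =ᵐ[Q] fun ω => X ω + Y ω := by
    refine hW.ae_eq hZ' (aestronglyMeasurable_kernel_indicator H t 0 t) ?_
    refine (hX.add hZ' (aestronglyMeasurable_kernel_indicator H t 0 T)
      (aestronglyMeasurable_kernel_indicator H t T t) hY).congr_ae (Eventually.of_forall fun u => ?_)
    simp only
    by_cases h1 : u ∈ Ioc (0 : ℝ) T
    · rw [indicator_of_mem h1, indicator_of_notMem (fun h => not_lt_of_ge h1.2 h.1),
        indicator_of_mem (show u ∈ Ioc (0 : ℝ) t from ⟨h1.1, h1.2.trans hTt⟩), add_zero]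
    · rw [indicator_of_notMem h1, zero_add]
      by_cases h2 : u ∈ Ioc (T : ℝ) t
      · rw [indicator_of_mem h2, indicator_of_mem
          (show u ∈ Ioc (0 : ℝ) t from ⟨hT0.trans_lt h2.1, h2.2⟩)]
      · rw [indicator_of_notMem h2, indicator_of_notMem]
        intro h3
        exact h2 ⟨not_le.1 fun h4 => h1 ⟨h3.1, h4⟩, h3.2⟩
  set b := ξ₀ t * Real.exp (-(κ ^ 2 / 2 * ((t : ℝ) ^ (2 * H) / (2 * H)))) with hb
  set f : Ω → ℝ := fun ω => b * Real.exp (κ * X ω) with hf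
  set g : Ω → ℝ := fun ω => Real.exp (κ * Y ω) with hg
  have hinst : instVariance Q Z ξ₀ ν H t =ᵐ[Q] f * g := by
    filter_upwards [hVW, hWXY] with ω h1 h2
    simp only [instVariance, hf, hg, hb, Pi.mul_apply]
    rw [h1, h2, mul_assoc (ξ₀ t), mul_assoc (ξ₀ t), ← Real.exp_add, ← Real.exp_add]
    congr 2
    ring
  have hfm : AEStronglyMeasurable[ℱ T] f Q :=
    (Real.continuous_exp.comp_aestronglyMeasurable (hXm.const_mul κ)).const_mul b
  have hfg : Integrable (f * g) Q := by
    refine (((hWexp κ).1.integrable (by norm_num)).const_mul b).congr ?_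
    filter_upwards [hWXY] with ω h
    simp only [hf, hg, Pi.mul_apply]
    rw [h, mul_assoc b, ← Real.exp_add, mul_add]
  -- The factor in `X` is known at time `T` and comes out of the conditional expectation; the factor
  -- in `Y` contributes a constant.
  have hpull := condExp_mul_of_aestronglyMeasurable_left hfm hfg (hYmem.integrable (by norm_num))
  have hconst := condExp_exp_eq hYmem hYint
  filter_upwards [condExp_congr_ae (m := ℱ T) hinst, hpull, hconst] with ω h1 h2 h3
  rw [h1, h2, Pi.mul_apply, h3, hf, hb]
  simp only
  rw [mul_assoc, mul_assoc, ← Real.exp_add, ← Real.exp_add]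
  congr 2
  rw [sub_self, Real.zero_rpow (by linarith)]
  ring

/-- Positivity and the first two moments of the forward variance. -/
lemma IsForwardVariance.moments (hZ : IsBrownianWrt Z ℱ Q) (hH0 : 0 < H) (hH : H < 1 / 2)
    {ν Δ : ℝ} {ξ₀ : ℝ → ℝ} {ξ : ℝ → Ω → ℝ} (hξ : IsForwardVariance Q ℱ Z ξ₀ ν H T Δ ξ)
    (hpos : ∀ t ∈ Icc (T : ℝ) (T + Δ), 0 < ξ₀ t) {t u : ℝ} (ht : t ∈ Icc (T : ℝ) (T + Δ))
    (hu : u ∈ Icc (T : ℝ) (T + Δ)) :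
    (∀ᵐ ω ∂Q, 0 < ξ t ω) ∧ MemLp (ξ t) 2 Q ∧ ∫ ω, ξ t ω ∂Q = ξ₀ t ∧
      ∫ ω, ξ u ω * ξ t ω ∂Q =
        ξ₀ u * ξ₀ t * Real.exp ((2 * ν * constC H) ^ 2 * kernelCov H T u t) := by
  have hprob := hZ.isBrownian.isGaussianProcess.isProbabilityMeasure
  have hZ' := hZ.isBrownian.toIsPreBrownianReal
  have hT0 : (0 : ℝ) ≤ T := T.2
  obtain ⟨X, hX, hXm, hXexp⟩ := exists_wienerIntegral_kernel hZ hH0 hH (zero_le (a := T)) ht.1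
  obtain ⟨Y, hY, hYm, hYexp⟩ := exists_wienerIntegral_kernel hZ hH0 hH (zero_le (a := T)) hu.1
  -- `W` is the Wiener integral of the sum of the two kernels. One exponential moment of `W = Y + X`
  -- replaces any joint law of `X` and `Y`.
  obtain ⟨W, hW, -, hWexp⟩ := exists_wienerIntegral_Ioc hZ (zero_le (a := T))
    ((isLeftApproximable_kernel (p := 0) (h := T - 0) (t := u) hH0 hH (by simpa using hu.1)).add
      (isLeftApproximable_kernel (p := 0) (h := T - 0) (t := t) hH0 hH (by simpa using ht.1)))
  rw [NNReal.coe_zero] at hX hY hW hXexp hWexp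
  rw [integral_kernel_add_sq hH0 hT0 ht.1 hu.1] at hWexp
  have hWXY : W =ᵐ[Q] fun ω => Y ω + X ω := by
    refine hW.ae_eq hZ' ?_ ?_
    · exact (Measurable.indicator (by fun_prop) measurableSet_Ioc).aestronglyMeasurable
    · refine (hY.add hZ' (aestronglyMeasurable_kernel_indicator H u 0 T)
        (aestronglyMeasurable_kernel_indicator H t 0 T) hX).congr_ae
        (Eventually.of_forall fun s => ?_)
      by_cases h1 : s ∈ Ioc (0 : ℝ) T <;> simp [h1]
  have et := (hξ.ae_eq_condExp t ht).trans (condExp_instVariance hZ hH0 hH ν ξ₀ ht.1 hX hXm)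
  have eu := (hξ.ae_eq_condExp u hu).trans (condExp_instVariance hZ hH0 hH ν ξ₀ hu.1 hY hYm)
  set κ := 2 * ν * constC H
  have et' : ξ t =ᵐ[Q] fun ω => ξ₀ t * Real.exp (-(κ ^ 2 / 2 *
      ((t ^ (2 * H) - (t - T) ^ (2 * H)) / (2 * H)))) * Real.exp (κ * X ω) := by
    filter_upwards [et] with ω h
    rw [h, mul_assoc (ξ₀ t), ← Real.exp_add]
    congr 2
    ring
  refine ⟨?_, ?_, ?_, ?_⟩
  · filter_upwards [et] with ω h
    rw [h]
    exact mul_pos (hpos t ht) (Real.exp_pos _)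
  · exact ((hXexp κ).1.const_mul _).ae_eq et'.symm
  · rw [integral_congr_ae et', integral_const_mul]
    have := (hXexp κ).2 univ MeasurableSet.univ
    rw [setIntegral_univ, probReal_univ, one_mul, sub_zero] at this
    rw [this, mul_assoc, ← Real.exp_add, neg_add_cancel, Real.exp_zero, mul_one]
  · have hprod : (fun ω => ξ u ω * ξ t ω) =ᵐ[Q] fun ω => ξ₀ u * ξ₀ t * Real.exp (-(κ ^ 2 / 2 *
        ((u ^ (2 * H) - (u - T) ^ (2 * H)) / (2 * H) +
          (t ^ (2 * H) - (t - T) ^ (2 * H)) / (2 * H)))) * Real.exp (κ * W ω) := by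
      filter_upwards [et, eu, hWXY] with ω h1 h2 h3
      rw [h1, h2, h3, mul_mul_mul_comm, ← Real.exp_add, mul_assoc (ξ₀ u * ξ₀ t), ← Real.exp_add]
      congr 2
      ring
    rw [integral_congr_ae hprod, integral_const_mul]
    have := (hWexp κ).2 univ MeasurableSet.univ
    rw [setIntegral_univ, probReal_univ, one_mul] at this
    rw [this, mul_assoc, ← Real.exp_add]
    congr 2
    ring

end Field

/-! ### Fubini for the integrated positive field -/

section Fubini

variable {α Ω : Type*} {mα : MeasurableSpace α} {mΩ : MeasurableSpace Ω} {μ : Measure α}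
  {Q : Measure Ω} {ξ : α → Ω → ℝ}

lemma quasiMeasurePreserving_prodMap_fst [SFinite μ] [SFinite Q] :
    Measure.QuasiMeasurePreserving (fun x : (α × α) × Ω => (x.1.1, x.2)) ((μ.prod μ).prod Q)
      (μ.prod Q) := by
  have hm : Measurable (fun x : (α × α) × Ω => (x.1.1, x.2)) := by fun_prop
  refine ⟨hm, Measure.AbsolutelyContinuous.mk fun s hs h => ?_⟩
  rw [Measure.map_apply hm hs, Measure.measure_prod_null (hm hs)]
  rw [Measure.measure_prod_null hs] at h
  exact Measure.quasiMeasurePreserving_fst.ae h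

lemma quasiMeasurePreserving_prodMap_snd [SFinite μ] [SFinite Q] :
    Measure.QuasiMeasurePreserving (fun x : (α × α) × Ω => (x.1.2, x.2)) ((μ.prod μ).prod Q)
      (μ.prod Q) := by
  have hm : Measurable (fun x : (α × α) × Ω => (x.1.2, x.2)) := by fun_prop
  refine ⟨hm, Measure.AbsolutelyContinuous.mk fun s hs h => ?_⟩
  rw [Measure.map_apply hm hs, Measure.measure_prod_null (hm hs)]
  rw [Measure.measure_prod_null hs] at h
  exact Measure.quasiMeasurePreserving_snd.ae h

variable [IsFiniteMeasure Q]

lemma integrable_uncurry_of_moments (hm : AEStronglyMeasurable (Function.uncurry ξ) (μ.prod Q))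
    {a : α → ℝ} (ha : Integrable a μ) (hint : ∀ᵐ t ∂μ, Integrable (ξ t) Q)
    (hpos : ∀ᵐ t ∂μ, ∀ᵐ ω ∂Q, 0 < ξ t ω) (hmean : ∀ᵐ t ∂μ, ∫ ω, ξ t ω ∂Q = a t) :
    Integrable (Function.uncurry ξ) (μ.prod Q) := by
  rw [integrable_prod_iff hm]
  refine ⟨hint, ha.congr ?_⟩
  filter_upwards [hpos, hmean] with t h1 h2
  rw [← h2]
  refine integral_congr_ae ?_
  filter_upwards [h1] with ω hω
  exact (Real.norm_of_nonneg hω.le).symm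

/-- Exchanging the two almost-everywhere quantifiers requires a measurable set in the product, so
positivity is first moved to a strongly measurable representative. -/
lemma ae_ae_pos [SFinite μ] (hm : AEStronglyMeasurable (Function.uncurry ξ) (μ.prod Q))
    (hpos : ∀ᵐ t ∂μ, ∀ᵐ ω ∂Q, 0 < ξ t ω) : ∀ᵐ ω ∂Q, ∀ᵐ t ∂μ, 0 < ξ t ω := by
  have hmk : ∀ᵐ t ∂μ, ∀ᵐ ω ∂Q, 0 < hm.mk _ (t, ω) := by
    filter_upwards [hpos, Measure.ae_ae_of_ae_prod hm.ae_eq_mk] with t h1 h2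
    filter_upwards [h1, h2] with ω h3 h4
    rw [← h4]
    exact h3
  have hset : MeasurableSet {x : α × Ω | 0 < hm.mk _ x} :=
    measurableSet_lt measurable_const hm.stronglyMeasurable_mk.measurable
  have h2 : ∀ᵐ x ∂(μ.prod Q), 0 < hm.mk _ x := (Measure.ae_prod_iff_ae_ae hset).2 hmk
  have h3 : ∀ᵐ x ∂(μ.prod Q), 0 < Function.uncurry ξ x := by
    filter_upwards [h2, hm.ae_eq_mk] with x h4 h5
    rw [h5]
    exact h4
  have h4 : ∀ᵐ x ∂(Q.prod μ), 0 < Function.uncurry ξ x.swap :=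
    (Measure.measurePreserving_swap (μ := Q) (ν := μ)).quasiMeasurePreserving.ae h3
  exact Measure.ae_ae_of_ae_prod h4

/-- Second moment of the integral of a positive random field. -/
lemma second_moment_of_field [SFinite μ] (hm : AEStronglyMeasurable (Function.uncurry ξ) (μ.prod Q))
    {a : α → ℝ} (ha : Integrable a μ) (hξ : Integrable (Function.uncurry ξ) (μ.prod Q))
    (hpos : ∀ᵐ t ∂μ, ∀ᵐ ω ∂Q, 0 < ξ t ω) (hmem : ∀ᵐ t ∂μ, MemLp (ξ t) 2 Q) {k : α × α → ℝ} {C : ℝ}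
    (hk : ∀ᵐ p ∂(μ.prod μ), ∫ ω, ξ p.1 ω * ξ p.2 ω ∂Q = k p)
    (hkC : ∀ᵐ p ∂(μ.prod μ), k p ≤ C * (a p.1 * a p.2)) :
    Integrable k (μ.prod μ) ∧ MemLp (fun ω => ∫ t, ξ t ω ∂μ) 2 Q ∧
      ∫ ω, (∫ t, ξ t ω ∂μ) ^ 2 ∂Q = ∫ p, k p ∂(μ.prod μ) := by
  set F : (α × α) × Ω → ℝ := fun x => ξ x.1.1 x.2 * ξ x.1.2 x.2 with hF
  have hFm : AEStronglyMeasurable F ((μ.prod μ).prod Q) :=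
    (hm.comp_quasiMeasurePreserving quasiMeasurePreserving_prodMap_fst).mul
      (hm.comp_quasiMeasurePreserving quasiMeasurePreserving_prodMap_snd)
  have hpos2 : ∀ᵐ p ∂(μ.prod μ), ∀ᵐ ω ∂Q, 0 < F (p, ω) := by
    filter_upwards [Measure.quasiMeasurePreserving_fst.ae hpos,
      Measure.quasiMeasurePreserving_snd.ae hpos] with p h1 h2
    filter_upwards [h1, h2] with ω h3 h4
    exact mul_pos h3 h4
  have hkm : AEStronglyMeasurable k (μ.prod μ) := hFm.integral_prod_right'.congr hk
  have hk0 : ∀ᵐ p ∂(μ.prod μ), 0 ≤ k p := by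
    filter_upwards [hk, hpos2] with p h1 h2
    rw [← h1]
    exact integral_nonneg_of_ae (h2.mono fun ω h => h.le)
  -- Since `k ≥ 0`, the one-sided bound by the integrable product `a ⊗ a` suffices.
  have hkint : Integrable k (μ.prod μ) := by
    refine ((ha.mul_prod ha).const_mul C).mono' hkm ?_
    filter_upwards [hk0, hkC] with p h1 h2
    rwa [Real.norm_of_nonneg h1]
  have hFint : Integrable F ((μ.prod μ).prod Q) := by
    rw [integrable_prod_iff hFm]
    refine ⟨?_, hkint.congr ?_⟩
    · filter_upwards [Measure.quasiMeasurePreserving_fst.ae hmem,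
        Measure.quasiMeasurePreserving_snd.ae hmem] with p h1 h2
      exact h1.integrable_mul h2
    · filter_upwards [hk, hpos2] with p h1 h2
      rw [← h1]
      refine integral_congr_ae ?_
      filter_upwards [h2] with ω hω
      exact (Real.norm_of_nonneg hω.le).symm
  -- The square of an integral is a double integral, which brings the correlation `k` into play
  -- after exchanging the order.
  have hsq : ∀ ω, (∫ t, ξ t ω ∂μ) ^ 2 = ∫ p, F (p, ω) ∂(μ.prod μ) := fun ω => by
    rw [sq, ← integral_prod_mul]
  have hDm : AEStronglyMeasurable (fun ω => ∫ t, ξ t ω ∂μ) Q :=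
    hξ.integral_prod_right.aestronglyMeasurable
  refine ⟨hkint, ?_, ?_⟩
  · rw [memLp_two_iff_integrable_sq hDm]
    simp_rw [hsq]
    exact hFint.integral_prod_right
  · simp_rw [hsq]
    rw [← integral_prod_symm F hFint, integral_prod F hFint]
    exact integral_congr_ae hk

end Fubini

/-! ### Matching a log-normal law to two moments -/

section LogNormal

lemma integral_exp_gaussianReal (a : ℝ) (v : ℝ≥0) :
    ∫ x, Real.exp x ∂(gaussianReal a v) = Real.exp (a + v / 2) := by
  have h := congrFun (mgf_fun_id_gaussianReal (μ := a) (v := v)) 1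
  simpa [mgf] using h

lemma integral_exp_sq_gaussianReal (a : ℝ) (v : ℝ≥0) :
    ∫ x, Real.exp x ^ 2 ∂(gaussianReal a v) = Real.exp (2 * a + 2 * v) := by
  have h := congrFun (mgf_fun_id_gaussianReal (μ := a) (v := v)) 2
  have h2 : ∀ x : ℝ, Real.exp x ^ 2 = Real.exp (2 * x) := fun x => by
    rw [sq, ← Real.exp_add]; congr 1; ring
  simp_rw [h2]
  rw [show 2 * a + 2 * (v : ℝ) = a * 2 + v * 2 ^ 2 / 2 by ring, ← h]
  rfl

/-- Taking logarithms gives the invertible linear system `a + v/2 = log M₁`, `2a + 2v = log M₂`. The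
case `v = 0` is included. -/
lemma gaussianReal_exp_moments_iff {M₁ M₂ : ℝ} (h₁ : 0 < M₁) (h₂ : 0 < M₂) (a : ℝ) (v : ℝ≥0) :
    (∫ x, Real.exp x ∂(gaussianReal a v) = M₁ ∧ ∫ x, Real.exp x ^ 2 ∂(gaussianReal a v) = M₂) ↔
      a = Real.log M₁ - (-2 * Real.log M₁ + Real.log M₂) / 2 ∧
        (v : ℝ) = -2 * Real.log M₁ + Real.log M₂ := by
  rw [integral_exp_gaussianReal, integral_exp_sq_gaussianReal]
  constructor
  · rintro ⟨rfl, rfl⟩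
    rw [Real.log_exp, Real.log_exp]
    constructor <;> ring
  · rintro ⟨ha, hv⟩
    constructor
    · rw [← Real.exp_log h₁]
      congr 1
      linarith
    · rw [← Real.exp_log h₂]
      congr 1
      linarith

lemma sq_integral_le_integral_sq {Ω : Type*} {mΩ : MeasurableSpace Ω} {Q : Measure Ω}
    [IsProbabilityMeasure Q] {D : Ω → ℝ} (hD : MemLp D 2 Q) :
    (∫ ω, D ω ∂Q) ^ 2 ≤ ∫ ω, D ω ^ 2 ∂Q := by
  have h := variance_nonneg D Q
  rw [variance_eq_sub hD] at h
  simpa using h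

end LogNormal

end

end RoughBergomi

/-! ### Assembly of the theorem -/

open RoughBergomi in
theorem proposition3p5 {Ω : Type*} {m : MeasurableSpace Ω} (Q : Measure Ω)
    [IsProbabilityMeasure Q] (ℱ : Filtration ℝ≥0 m) (Z : ℝ≥0 → Ω → ℝ)
    (hZ : RoughBergomi.IsBrownianWrt Z ℱ Q)
    (H ν : ℝ) (hH0 : 0 < H) (hH : H < 1 / 2) (hν : 0 < ν)
    (T : ℝ≥0) (Δ : ℝ) (hΔ : 0 < Δ)
    (ξ₀ : ℝ → ℝ) (hξ₀_pos : ∀ t ∈ Icc (T : ℝ) (T + Δ), 0 < ξ₀ t)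
    (hξ₀_int : IntegrableOn ξ₀ (Icc (T : ℝ) (T + Δ)))
    (ξ : ℝ → Ω → ℝ) (hξ : RoughBergomi.IsForwardVariance Q ℱ Z ξ₀ ν H T Δ ξ) :
    let D : Ω → ℝ := RoughBergomi.deltaVIXSq ξ T Δ
    let M₁ : ℝ := ∫ ω, D ω ∂Q
    let M₂ : ℝ := ∫ ω, D ω ^ 2 ∂Q
    let σsq : ℝ := -2 * Real.log M₁ + Real.log M₂
    let μ : ℝ := Real.log M₁ - σsq / 2
    -- all the integrals below are well defined
    (∀ᵐ ω ∂Q, IntegrableOn (fun t => ξ t ω) (Icc (T : ℝ) (T + Δ))) ∧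
    (∀ᵐ ω ∂Q, 0 < D ω) ∧
    MemLp D 2 Q ∧
    IntegrableOn (RoughBergomi.secondMomentIntegrand ξ₀ ν H T)
      (Icc (T : ℝ) (T + Δ) ×ˢ Icc (T : ℝ) (T + Δ)) ∧
    -- the first two moments
    M₁ = ∫ t in (T : ℝ)..(T + Δ), ξ₀ t ∧
    M₂ = ∫ p in Icc (T : ℝ) (T + Δ) ×ˢ Icc (T : ℝ) (T + Δ),
      RoughBergomi.secondMomentIntegrand ξ₀ ν H T p ∧
    -- variance and mean of the logarithm when `D` is log-normal
    ((∃ (a : ℝ) (v : ℝ≥0), HasLaw (fun ω => Real.log (D ω)) (gaussianReal a v) Q) →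
      Var[fun ω => Real.log (D ω); Q] = σsq ∧ ∫ ω, Real.log (D ω) ∂Q = μ) ∧
    -- `σsq` and `μ` are the parameters of the unique log-normal law with the moments of `D`
    0 ≤ σsq ∧
    ∀ (a : ℝ) (v : ℝ≥0),
      ((∫ x, Real.exp x ∂(gaussianReal a v) = M₁ ∧
        ∫ x, Real.exp x ^ 2 ∂(gaussianReal a v) = M₂) ↔ a = μ ∧ (v : ℝ) = σsq) := by
  intro D M₁ M₂ σsq μ
  have hT0 : (0 : ℝ) ≤ T := T.2
  set S := Icc (T : ℝ) (T + Δ) with hS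
  set lam : Measure ℝ := volume.restrict S with hlam
  have hle : (T : ℝ) ≤ T + Δ := by linarith
  have hinterval : ∀ f : ℝ → ℝ, ∫ t in (T : ℝ)..(T + Δ), f t = ∫ t, f t ∂lam := fun f => by
    rw [intervalIntegral.integral_of_le hle, ← integral_Icc_eq_integral_Ioc]
  have hD : D = fun ω => ∫ t, ξ t ω ∂lam := funext fun ω => hinterval _
  have hS_ae : ∀ᵐ t ∂lam, t ∈ S := ae_restrict_mem measurableSet_Icc
  have hm := hξ.jointlyMeasurable
  have hmom := fun {t u : ℝ} (ht : t ∈ S) (hu : u ∈ S) => hξ.moments hZ hH0 hH hξ₀_pos ht hu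
  have hpos : ∀ᵐ t ∂lam, ∀ᵐ ω ∂Q, 0 < ξ t ω := hS_ae.mono fun t ht => (hmom ht ht).1
  have hmem : ∀ᵐ t ∂lam, MemLp (ξ t) 2 Q := hS_ae.mono fun t ht => (hmom ht ht).2.1
  have hmean : ∀ᵐ t ∂lam, ∫ ω, ξ t ω ∂Q = ξ₀ t := hS_ae.mono fun t ht => (hmom ht ht).2.2.1
  have hξint := integrable_uncurry_of_moments hm hξ₀_int
    (hmem.mono fun t h => h.integrable (by norm_num)) hpos hmean
  have hprod_ae : ∀ᵐ p ∂(lam.prod lam), p.1 ∈ S ∧ p.2 ∈ S :=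
    (Measure.quasiMeasurePreserving_fst.ae hS_ae).and (Measure.quasiMeasurePreserving_snd.ae hS_ae)
  have hne : ∀ᵐ p ∂(lam.prod lam), p.1 ≠ p.2 := by
    have : MeasurableSet {p : ℝ × ℝ | p.1 ≠ p.2} :=
      (measurableSet_eq_fun measurable_fst measurable_snd).compl
    rw [Measure.ae_prod_iff_ae_ae this]
    refine Filter.Eventually.of_forall fun x => ?_
    have hx : ∀ᵐ y : ℝ ∂lam, y ≠ x := by simp [ae_iff]
    exact hx.mono fun y hy => hy.symm
  have hk : ∀ᵐ p ∂(lam.prod lam),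
      ∫ ω, ξ p.1 ω * ξ p.2 ω ∂Q = secondMomentIntegrand ξ₀ ν H T p := by
    filter_upwards [hprod_ae, hne] with p hp hpne
    rw [secondMomentIntegrand_eq hH0 hT0 hp.1.1 hp.2.1 hpne, (hmom hp.2 hp.1).2.2.2]
  have hkC : ∀ᵐ p ∂(lam.prod lam), secondMomentIntegrand ξ₀ ν H T p ≤
      Real.exp ((2 * ν * constC H) ^ 2 * ((T + Δ) ^ (2 * H) / (2 * H))) *
        (ξ₀ p.1 * ξ₀ p.2) := by
    filter_upwards [hprod_ae, hne] with p hp hpne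
    rw [secondMomentIntegrand_eq hH0 hT0 hp.1.1 hp.2.1 hpne, mul_comm]
    refine mul_le_mul_of_nonneg_right (Real.exp_le_exp.2 (mul_le_mul_of_nonneg_left ?_
      (sq_nonneg _))) (mul_pos (hξ₀_pos _ hp.1) (hξ₀_pos _ hp.2)).le
    exact kernelCov_le hH0 hT0 hp.2.1 hp.1.1 hp.2.2 hp.1.2
  obtain ⟨hkint, hDmem, hDsq⟩ := second_moment_of_field hm hξ₀_int hξint hpos hmem hk hkC
  rw [← hD] at hDmem
  have hDint : ∀ᵐ ω ∂Q, Integrable (fun t => ξ t ω) lam := hξint.prod_left_ae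
  have hlam_ne : lam ≠ 0 := by
    rw [hlam, Ne, Measure.restrict_eq_zero, hS, Real.volume_Icc]
    simpa using hΔ
  have hDpos : ∀ᵐ ω ∂Q, 0 < D ω := by
    filter_upwards [hDint, ae_ae_pos hm hpos] with ω h1 h2
    rw [hD]
    have h3 : 0 ≤ᵐ[lam] fun t => ξ t ω := h2.mono fun t h => h.le
    -- A vanishing integral would force the field to be zero almost everywhere, against its
    -- positivity, since an interval of length `Δ > 0` is not null.
    refine lt_of_le_of_ne (integral_nonneg_of_ae h3) fun h4 => hlam_ne ?_
    have h5 := (integral_eq_zero_iff_of_nonneg_ae h3 h1).1 h4.symm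
    rw [← ae_eq_bot, ← Filter.eventually_false_iff_eq_bot]
    filter_upwards [h2, h5] with t h6 h7
    exact h6.ne' h7
  have hM₁ : M₁ = ∫ t in (T : ℝ)..(T + Δ), ξ₀ t := by
    rw [hinterval]
    change ∫ ω, D ω ∂Q = _
    rw [hD, ← integral_integral_swap hξint]
    exact integral_congr_ae hmean
  have hprodS : lam.prod lam = (volume : Measure (ℝ × ℝ)).restrict (S ×ˢ S) := by
    rw [hlam, Measure.prod_restrict]
    rfl
  have hM₂ : M₂ = ∫ p in S ×ˢ S, secondMomentIntegrand ξ₀ ν H T p := by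
    rw [← hprodS, ← hDsq]
    change ∫ ω, D ω ^ 2 ∂Q = _
    rw [hD]
  have hM₁pos : 0 < M₁ := by
    refine (integral_pos_iff_support_of_nonneg_ae (hDpos.mono fun ω h => h.le)
      (hDmem.integrable (by norm_num))).2 ?_
    have : Function.support D =ᵐ[Q] univ := by
      filter_upwards [hDpos] with ω h
      exact eq_true (Function.mem_support.2 h.ne')
    rw [measure_congr this, measure_univ]
    exact one_pos
  -- Nonnegativity of the variance of `D` gives both `M₂ > 0`, so that the logarithm is meaningful,
  -- and `σsq ≥ 0`.
  have hsq : M₁ ^ 2 ≤ M₂ := sq_integral_le_integral_sq hDmem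
  have hM₂pos : 0 < M₂ := (pow_pos hM₁pos 2).trans_le hsq
  have hiff := gaussianReal_exp_moments_iff hM₁pos hM₂pos
  refine ⟨hDint, hDpos, hDmem, ?_, hM₁, hM₂, ?_, ?_, hiff⟩
  · rw [IntegrableOn, ← hprodS]
    exact hkint
  · rintro ⟨a, v, hlaw⟩
    -- As `D > 0` almost surely, `exp (log D) = D`; the Gaussian law of `log D` therefore has the
    -- matching exponential moments, and uniqueness determines its parameters.
    have h1 : ∫ x, Real.exp x ∂(gaussianReal a v) = M₁ := by
      rw [← hlaw.integral_comp (by fun_prop)]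
      refine integral_congr_ae ?_
      filter_upwards [hDpos] with ω h
      exact Real.exp_log h
    have h2 : ∫ x, Real.exp x ^ 2 ∂(gaussianReal a v) = M₂ := by
      rw [← hlaw.integral_comp (f := fun x => Real.exp x ^ 2) (by fun_prop)]
      refine integral_congr_ae ?_
      filter_upwards [hDpos] with ω h
      simp only [Function.comp_apply]
      rw [Real.exp_log h]
    obtain ⟨ha, hv⟩ := (hiff a v).1 ⟨h1, h2⟩
    constructor
    · rw [hlaw.variance_eq, variance_id_gaussianReal]
      exact hv
    · rw [hlaw.integral_eq, integral_id_gaussianReal]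
      exact ha
  · have := Real.log_le_log (pow_pos hM₁pos 2) hsq
    rw [Real.log_pow] at this
    push_cast at this
    change 0 ≤ -2 * Real.log M₁ + Real.log M₂
    linarith
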